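/- Let $\mathcal R$ be Riemann's auxiliary function, the entire function \[ \mathcal R(s)=\int_{0\swarrow 1}\frac{x^{-s}e^{\pi i x^2}}{e^{\pi i x}-e^{-\pi i x}}\,dx , \] where the integral is taken along a straight line of direction $e^{\pi i/4}$ that crosses the real axis at a point strictly between $0$ and $1$ (for example at $1/2$), traversed from the upper right to the lower left, and $x^{-s}=e^{-s\log x}$ with the principal branch of the logarithm. Write $s=\sigma+it$ with $\sigma,t$ real. Then \[ \Bigl|\mathcal R(s)-\sum_{1\le n\le\sqrt{t/2\pi}}\frac1{n^s}\Bigr|\le\Bigl(\frac t{2\pi}\Bigr)^{-\sigma/2}\qquad\text{for } 0\le\sigma\le1,\ t\ge3\pi, \] and \[ \Bigl|\mathcal R(s)-\sum_{1\le n\le\sqrt{t/2\pi}}\frac1{n^s}\Bigr|\le\Bigl(\frac t{2\pi}\Bigr)^{-1/2}\qquad\text{for } \sigma\ge1,\ t\ge16\pi . \] -/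

import Mathlib

noncomputable section

/-- The integrand `x^{-s} e^{πi x²} / (e^{πi x} - e^{-πi x})` of Riemann's auxiliary function;
the power is taken with the principal branch of the logarithm. -/
def riemannAuxIntegrand (s x : ℂ) : ℂ :=
  x ^ (-s) * Complex.exp (Real.pi * Complex.I * x ^ 2) /
    (Complex.exp (Real.pi * Complex.I * x) - Complex.exp (-(Real.pi * Complex.I * x)))

/-- The straight line `u ↦ 1/2 + u e^{πi/4}`, of slope one, which crosses the real axis only
at `1/2`. -/
def riemannAuxLine (u : ℝ) : ℂ :=
  1 / 2 + u * Complex.exp (Real.pi * Complex.I / 4)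

/-- Riemann's auxiliary function
`R(s) = ∫_{0 ↙ 1} x^{-s} e^{πi x²} / (e^{πi x} - e^{-πi x}) dx`,
the integral being taken along a line of slope one that crosses the real axis between `0` and `1`,
run through from the upper right to the lower left. All such lines give the same value; we take
the one through `1/2`. On it `dx = e^{πi/4} du`, and the minus sign is the orientation `↙`. -/
def riemannAux (s : ℂ) : ℂ :=
  -∫ u : ℝ, riemannAuxIntegrand s (riemannAuxLine u) * Complex.exp (Real.pi * Complex.I / 4)

end

/-! Put a = √(t/2π), N = ⌊a⌋ and c = N + 1/2. Moving the line of integration from 1/2 to c crosses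
the simple poles 1, …, N, each contributing n^{-s} (`integral_halfLine_sub_integral_halfLine`,
`riemannAux_sub_sum`). The error is then the integral over a line crossing the axis within 1/2 of a,
the saddle point of x^{-it} e^{πix²}.

On x = c + v(1+i) the integrand has modulus ‖x‖^{-σ} exp(2π(a² arg x − cv − v²)) / |e^{πix} −
e^{−πix}|. The denominator is at least 2, and at least 4 once |v| ≥ 1/2. Since |dx| = √2 dv, it
suffices that the remaining weighted integral be at most √2 (`norm_integral_halfLine_le`).

Write a = c(1+δ). For −c/2 ≤ v ≤ 3c/8 the phase lies below a quadratic, giving a Gaussian integral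
that uses nearly the whole budget. To the right the phase has a linear bound, and to the left arg x
≤ −π/4; both tails are tiny (`exists_majorant_integral_le_sqrt_two`).

Only the weights 1 (σ = 0) and a/‖x‖ (σ = 1) need estimating: weighted AM–GM interpolates for 0 ≤ σ
≤ 1, and ‖x‖ ≥ 1 reduces σ ≥ 1 to σ = 1. -/

open MeasureTheory Filter Topology

/-! ### Residue of a simple pole in a horizontal strip -/

/-- The integral of the difference of the values of `1 / w` on two horizontal lines symmetric about
the real axis. -/
theorem integral_inv_sub_inv_horizontal {b : ℝ} (hb : 0 < b) :
    Integrable (fun x : ℝ => ((x : ℂ) + (-b : ℝ) * Complex.I)⁻¹ - ((x : ℂ) + b * Complex.I)⁻¹) ∧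
    ∫ x : ℝ, (((x : ℂ) + (-b : ℝ) * Complex.I)⁻¹ - ((x : ℂ) + b * Complex.I)⁻¹) =
      2 * Real.pi * Complex.I := by
  have key : ∀ x : ℝ, ((x : ℂ) + (-b : ℝ) * Complex.I)⁻¹ - ((x : ℂ) + b * Complex.I)⁻¹ =
      (2 * Complex.I / b) * (((1 + (x / b) ^ 2)⁻¹ : ℝ) : ℂ) := by
    intro x
    have h1 : (x : ℂ) + (-b : ℝ) * Complex.I ≠ 0 := by
      intro h
      have := congrArg Complex.im h
      simp at this
      linarith
    have h2 : (x : ℂ) + b * Complex.I ≠ 0 := by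
      intro h
      have := congrArg Complex.im h
      simp at this
      linarith
    have hb' : (b : ℂ) ≠ 0 := by exact_mod_cast hb.ne'
    have h3 : (1 + (x / b : ℂ) ^ 2) ≠ 0 := by
      have : (0 : ℝ) < 1 + (x / b) ^ 2 := by positivity
      exact_mod_cast this.ne'
    have h4 : (b : ℂ) ^ 2 + x ^ 2 ≠ 0 := by
      have : (0 : ℝ) < b ^ 2 + x ^ 2 := by positivity
      exact_mod_cast this.ne'
    have h5 : ((x : ℂ) + (-b : ℝ) * Complex.I) * (x + b * Complex.I) = b ^ 2 + x ^ 2 := by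
      push_cast
      ring_nf
      rw [Complex.I_sq]
      ring
    rw [inv_sub_inv h1 h2, h5]
    push_cast
    field_simp
    ring
  simp_rw [key]
  have hi : Integrable (fun x : ℝ => (1 + (x / b) ^ 2)⁻¹) :=
    integrable_inv_one_add_sq.comp_div hb.ne'
  refine ⟨hi.ofReal.const_mul _, ?_⟩
  rw [integral_const_mul, integral_complex_ofReal,
    Measure.integral_comp_div (fun x : ℝ => (1 + x ^ 2)⁻¹) b, integral_univ_inv_one_add_sq,
    abs_of_pos hb]
  have hb' : (b : ℂ) ≠ 0 := by exact_mod_cast hb.ne'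
  simp only [smul_eq_mul]
  push_cast
  field_simp

/-- Residue theorem for a horizontal strip containing one simple pole, at the origin. -/
theorem integral_strip_sub_integral_strip {M : ℂ → ℂ} {b T₀ : ℝ} (hb : 0 < b) {U : Set ℂ}
    (hU : IsOpen U) (hsub : ∀ w : ℂ, |w.im| ≤ b → w ∈ U) (hM : DifferentiableOn ℂ M U)
    {D : ℝ → ℝ} (hD : Tendsto D atTop (𝓝 0))
    (hMD : ∀ w : ℂ, |w.im| ≤ b → T₀ ≤ |w.re| → ‖M w / w‖ ≤ D |w.re|)
    (h₁ : Integrable fun x : ℝ => M (x + (-b : ℝ) * Complex.I) / (x + (-b : ℝ) * Complex.I))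
    (h₂ : Integrable fun x : ℝ => M (x + b * Complex.I) / (x + b * Complex.I)) :
    (∫ x : ℝ, M (x + (-b : ℝ) * Complex.I) / (x + (-b : ℝ) * Complex.I)) -
      ∫ x : ℝ, M (x + b * Complex.I) / (x + b * Complex.I) = 2 * Real.pi * Complex.I * M 0 := by
  -- Subtracting M 0 / w removes the pole, so Cauchy's theorem on rectangles applies; the subtracted
  -- term returns the residue through its explicit integral.
  set h : ℂ → ℂ := dslope M 0 with hh
  have hval : ∀ w : ℂ, w ≠ 0 → h w = M w / w - M 0 * w⁻¹ := by
    intro w hw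
    rw [hh, dslope_of_ne _ hw, slope_def_field]
    rw [sub_zero, sub_div, div_eq_mul_inv (M 0)]
  have hdiff : DifferentiableOn ℂ h U :=
    (Complex.differentiableOn_dslope (hU.mem_nhds (hsub 0 (by simpa using hb.le)))).2 hM
  have hcont : ContinuousOn h U := hdiff.continuousOn
  have hne : ∀ (x y : ℝ), y ≠ 0 → (x : ℂ) + y * Complex.I ≠ 0 := by
    intro x y hy h0
    have := congrArg Complex.im h0
    simp at this
    exact hy this
  have hrect : ∀ T : ℝ, (∫ x : ℝ in (-T)..T, h (x + (-b : ℝ) * Complex.I)) -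
      (∫ x : ℝ in (-T)..T, h (x + b * Complex.I)) +
      Complex.I • (∫ y : ℝ in (-b)..b, h (T + y * Complex.I)) -
      Complex.I • (∫ y : ℝ in (-b)..b, h ((-T : ℝ) + y * Complex.I)) = 0 := by
    intro T
    have := Complex.integral_boundary_rect_eq_zero_of_differentiableOn h ⟨-T, -b⟩ ⟨T, b⟩
      (hdiff.mono ?_)
    · simpa using this
    · intro w hw
      refine hsub w ?_
      have h2 := hw.2
      simp only [Set.mem_preimage] at h2
      rw [Set.uIcc_of_le (by linarith)] at h2
      exact abs_le.2 h2
  have hlim : Tendsto (fun T : ℝ => (∫ x : ℝ in (-T)..T, h (x + (-b : ℝ) * Complex.I)) -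
      ∫ x : ℝ in (-T)..T, h (x + b * Complex.I)) atTop
      (𝓝 ((∫ x : ℝ, M (x + (-b : ℝ) * Complex.I) / (x + (-b : ℝ) * Complex.I)) -
      (∫ x : ℝ, M (x + b * Complex.I) / (x + b * Complex.I)) -
      M 0 * (2 * Real.pi * Complex.I))) := by
    obtain ⟨hi, hv⟩ := integral_inv_sub_inv_horizontal hb
    have hI := ((h₁.sub h₂).sub (hi.const_mul (M 0)))
    have := intervalIntegral_tendsto_integral hI tendsto_neg_atTop_atBot tendsto_id
    rw [integral_sub' (h₁.sub h₂) (hi.const_mul (M 0)), integral_sub' h₁ h₂, integral_const_mul,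
      hv] at this
    refine this.congr fun T => ?_
    have hint : ∀ k : ℝ, |k| ≤ b → IntervalIntegrable (fun x : ℝ => h (x + k * Complex.I))
        volume (-T) T := by
      intro k hk
      refine ContinuousOn.intervalIntegrable ?_
      refine hcont.comp (by fun_prop) fun x _ => hsub _ (by simpa using hk)
    rw [← intervalIntegral.integral_sub (hint _ (by simp [abs_of_pos hb]))
      (hint _ (by simp [abs_of_pos hb]))]
    refine intervalIntegral.integral_congr fun x _ => ?_
    simp only [Pi.sub_apply]
    rw [hval _ (hne x (-b) (by linarith)), hval _ (hne x b hb.ne')]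
    ring
  have hside : ∀ (S : ℝ → ℝ), (∀ T, |S T| = |T|) →
      Tendsto (fun T : ℝ => ∫ y : ℝ in (-b)..b, h ((S T : ℝ) + y * Complex.I)) atTop (𝓝 0) := by
    intro S hS
    have hlim0 : Tendsto (fun T : ℝ => (D T + ‖M 0‖ * T⁻¹) * |b - -b|) atTop (𝓝 0) := by
      have : Tendsto (fun T : ℝ => ‖M 0‖ * T⁻¹) atTop (𝓝 (‖M 0‖ * 0)) :=
        tendsto_inv_atTop_zero.const_mul _
      simpa using (hD.add this).mul_const |b - -b|
    refine squeeze_zero_norm' ?_ hlim0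
    filter_upwards [eventually_ge_atTop T₀, eventually_gt_atTop 0] with T hT hT0
    refine intervalIntegral.norm_integral_le_of_norm_le_const fun y hy => ?_
    rw [Set.uIoc_of_le (by linarith)] at hy
    have hre : ((S T : ℂ) + y * Complex.I).re = S T := by simp
    have him : ((S T : ℂ) + y * Complex.I).im = y := by simp
    have habs : |S T| = T := by rw [hS, abs_of_pos hT0]
    have hnorm : T ≤ ‖(S T : ℂ) + y * Complex.I‖ := by
      have := Complex.abs_re_le_norm ((S T : ℂ) + y * Complex.I)
      rwa [hre, habs] at this
    have hw : (S T : ℂ) + y * Complex.I ≠ 0 := norm_pos_iff.1 (hT0.trans_le hnorm)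
    rw [hval _ hw]
    refine (norm_sub_le _ _).trans (add_le_add ?_ ?_)
    · have := hMD ((S T : ℂ) + y * Complex.I) (by rw [him]; exact abs_le.2 ⟨hy.1.le, hy.2⟩)
        (by rw [hre, habs]; exact hT)
      rwa [hre, habs] at this
    · rw [norm_mul, norm_inv]
      gcongr
  have h0 : Tendsto (fun T : ℝ => (∫ x : ℝ in (-T)..T, h (x + (-b : ℝ) * Complex.I)) -
      ∫ x : ℝ in (-T)..T, h (x + b * Complex.I)) atTop (𝓝 0) := by
    have hA := (hside (fun T => -T) (fun T => abs_neg T)).const_smul Complex.I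
    have hB := (hside (fun T => T) (fun T => rfl)).const_smul Complex.I
    have := hA.sub hB
    rw [smul_zero, sub_zero] at this
    refine this.congr fun T => ?_
    linear_combination -(hrect T)
  have := tendsto_nhds_unique hlim h0
  linear_combination this

/-! ### The integrand on lines of slope one -/

/-- This is |2 sin πx|². Either square can be dropped for a lower bound, and their joint vanishing
locates the poles at the integers. -/
theorem normSq_exp_sub_exp_neg (x : ℂ) :
    ‖Complex.exp (Real.pi * Complex.I * x) - Complex.exp (-(Real.pi * Complex.I * x))‖ ^ 2 =
      4 * (Real.sinh (Real.pi * x.im) ^ 2 + Real.sin (Real.pi * x.re) ^ 2) := by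
  rw [Complex.sq_norm, Complex.normSq_apply]
  have h1 : (Real.pi * Complex.I * x).re = -(Real.pi * x.im) := by simp
  have h2 : (Real.pi * Complex.I * x).im = Real.pi * x.re := by simp
  simp only [Complex.sub_re, Complex.sub_im, Complex.exp_re, Complex.exp_im, Complex.neg_re,
    Complex.neg_im, h1, h2, neg_neg, Real.cos_neg, Real.sin_neg]
  rw [Real.sinh_eq]
  have h3 := Real.sin_sq_add_cos_sq (Real.pi * x.re)
  have h4 : Real.exp (Real.pi * x.im) * Real.exp (-(Real.pi * x.im)) = 1 := by
    rw [← Real.exp_add]; simp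
  have h5 : Real.cos (Real.pi * x.re) ^ 2 = 1 - Real.sin (Real.pi * x.re) ^ 2 := by linarith
  linear_combination (Real.exp (Real.pi * x.im) - Real.exp (-(Real.pi * x.im))) ^ 2 * h5 +
    4 * Real.sin (Real.pi * x.re) ^ 2 * h4

theorem two_mul_sinh_le_norm_exp_sub_exp_neg (x : ℂ) :
    2 * |Real.sinh (Real.pi * x.im)| ≤
      ‖Complex.exp (Real.pi * Complex.I * x) - Complex.exp (-(Real.pi * Complex.I * x))‖ := by
  refine le_of_pow_le_pow_left₀ two_ne_zero (norm_nonneg _) ?_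
  rw [normSq_exp_sub_exp_neg, mul_pow, sq_abs]
  nlinarith [sq_nonneg (Real.sin (Real.pi * x.re))]

theorem norm_riemannAuxIntegrand (s : ℂ) {x : ℂ} (hx : x ≠ 0) :
    ‖riemannAuxIntegrand s x‖ = ‖x‖ ^ (-s.re) * Real.exp (s.im * x.arg - 2 * Real.pi * (x.re * x.im)) /
      ‖Complex.exp (Real.pi * Complex.I * x) - Complex.exp (-(Real.pi * Complex.I * x))‖ := by
  rw [riemannAuxIntegrand, norm_div, norm_mul, Complex.norm_cpow_of_ne_zero hx, Complex.norm_exp]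
  have h : (Real.pi * Complex.I * x ^ 2).re = -(2 * Real.pi * (x.re * x.im)) := by
    simp [pow_two]; ring
  rw [h, Complex.neg_re, Complex.neg_im, div_eq_mul_inv (‖x‖ ^ (-s.re)), ← Real.exp_neg, mul_assoc,
    ← Real.exp_add]
  ring_nf

/-- The line of slope one through the half-integer `m + 1/2`. -/
noncomputable def halfLine (m : ℕ) (v : ℝ) : ℂ := ((m : ℝ) + 1 / 2 : ℝ) + v * (1 + Complex.I)

theorem halfLine_re (m : ℕ) (v : ℝ) : (halfLine m v).re = m + 1 / 2 + v := by
  simp [halfLine]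

theorem halfLine_im (m : ℕ) (v : ℝ) : (halfLine m v).im = v := by
  simp [halfLine]

theorem halfLine_mem_slitPlane (m : ℕ) (v : ℝ) : halfLine m v ∈ Complex.slitPlane := by
  rw [Complex.mem_slitPlane_iff, halfLine_re, halfLine_im]
  by_cases hv : v = 0
  · left; rw [hv]; positivity
  · right; exact hv

theorem norm_halfLine_sq (m : ℕ) (v : ℝ) :
    ‖halfLine m v‖ ^ 2 = (m + 1 / 2 + v) ^ 2 + v ^ 2 := by
  rw [Complex.sq_norm, Complex.normSq_apply, halfLine_re, halfLine_im]; ring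

theorem continuous_halfLine (m : ℕ) : Continuous (halfLine m) := by
  unfold halfLine; fun_prop

theorem normSq_exp_sub_exp_neg_halfLine (m : ℕ) (v : ℝ) :
    ‖Complex.exp (Real.pi * Complex.I * halfLine m v) -
      Complex.exp (-(Real.pi * Complex.I * halfLine m v))‖ ^ 2 =
      4 * (Real.sinh (Real.pi * v) ^ 2 + Real.cos (Real.pi * v) ^ 2) := by
  rw [normSq_exp_sub_exp_neg, halfLine_re, halfLine_im]
  have : Real.sin (Real.pi * (m + 1 / 2 + v)) ^ 2 = Real.cos (Real.pi * v) ^ 2 := by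
    rw [show Real.pi * (m + 1 / 2 + v) = (Real.pi * v + Real.pi / 2) + m * Real.pi by ring,
      Real.sin_add_nat_mul_pi, Real.sin_add_pi_div_two, mul_pow, ← pow_mul, mul_comm m 2, pow_mul]
    simp
  rw [this]

/-- Through a half-integer the sine becomes a cosine, and sinh² + cos² ≥ sin² + cos² = 1. -/
theorem two_le_norm_exp_sub_exp_neg_halfLine (m : ℕ) (v : ℝ) :
    2 ≤ ‖Complex.exp (Real.pi * Complex.I * halfLine m v) -
      Complex.exp (-(Real.pi * Complex.I * halfLine m v))‖ := by
  refine le_of_pow_le_pow_left₀ two_ne_zero (norm_nonneg _) ?_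
  rw [normSq_exp_sub_exp_neg_halfLine]
  have h1 : Real.sin (Real.pi * v) ^ 2 ≤ Real.sinh (Real.pi * v) ^ 2 := by
    have h2 : |Real.sin (Real.pi * v)| ≤ |Real.pi * v| := Real.abs_sin_le_abs
    have h3 : |Real.pi * v| ≤ |Real.sinh (Real.pi * v)| := by
      rw [Real.abs_sinh]
      exact Real.self_le_sinh_iff.2 (abs_nonneg _)
    exact sq_le_sq.2 (h2.trans h3)
  nlinarith [Real.sin_sq_add_cos_sq (Real.pi * v)]

/-- Here sinh alone suffices, because sinh(π/2) > 2; the gain of a factor 2 is spent in the tails.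
-/
theorem four_le_norm_exp_sub_exp_neg_halfLine (m : ℕ) {v : ℝ} (hv : 1 / 2 ≤ |v|) :
    4 ≤ ‖Complex.exp (Real.pi * Complex.I * halfLine m v) -
      Complex.exp (-(Real.pi * Complex.I * halfLine m v))‖ := by
  refine le_trans ?_ (two_mul_sinh_le_norm_exp_sub_exp_neg _)
  rw [halfLine_im, Real.abs_sinh, abs_mul, abs_of_pos Real.pi_pos]
  have h1 : Real.pi * (1 / 2) ≤ Real.pi * |v| := by gcongr
  have h2 := Real.sinh_le_sinh.2 h1
  have h3 : (2 : ℝ) ≤ Real.sinh (Real.pi * (1 / 2)) := by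
    have h4 : (4.5 : ℝ) ≤ Real.exp (Real.pi * (1 / 2)) := by
      have h7 := Real.sum_le_exp_of_nonneg (x := 3.14 * (1 / 2)) (by norm_num) 6
      have h8 : Real.exp (3.14 * (1 / 2)) ≤ Real.exp (Real.pi * (1 / 2)) := by
        gcongr; exact Real.pi_gt_d2.le
      refine le_trans ?_ (h7.trans h8)
      norm_num [Finset.sum_range_succ, Nat.factorial]
    have h5 : Real.exp (-(Real.pi * (1 / 2))) ≤ 1 / 4.5 := by
      rw [Real.exp_neg, ← one_div]; gcongr
    rw [Real.sinh_eq]; norm_num at h5 ⊢; linarith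
  linarith

theorem continuous_riemannAuxIntegrand_halfLine (s : ℂ) (m : ℕ) :
    Continuous fun v => riemannAuxIntegrand s (halfLine m v) := by
  unfold riemannAuxIntegrand
  have hc := continuous_halfLine m
  refine Continuous.div (Continuous.mul ?_ (by fun_prop)) (by fun_prop) fun v => ?_
  · exact hc.cpow continuous_const (fun v => halfLine_mem_slitPlane m v)
  · exact norm_pos_iff.1 (by linarith [two_le_norm_exp_sub_exp_neg_halfLine m v])

theorem half_le_norm_halfLine (m : ℕ) (v : ℝ) : (m + 1 / 2) / √2 ≤ ‖halfLine m v‖ := by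
  refine le_of_pow_le_pow_left₀ two_ne_zero (norm_nonneg _) ?_
  rw [norm_halfLine_sq, div_pow, Real.sq_sqrt (by norm_num)]
  nlinarith [sq_nonneg ((m : ℝ) + 1 / 2 + 2 * v)]

theorem integrable_exp_quadratic {B : ℝ} (hB : 0 < B) (A : ℝ) :
    Integrable fun v : ℝ => Real.exp (A * v - B * v ^ 2) := by
  have h := ((integrable_exp_neg_mul_sq hB).comp_sub_right (A / (2 * B))).const_mul
    (Real.exp (A ^ 2 / (4 * B)))
  refine h.congr (Eventually.of_forall fun v => ?_)
  simp only [← Real.exp_add]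
  congr 1
  field_simp
  ring

theorem integral_exp_quadratic {B : ℝ} (hB : 0 < B) (A : ℝ) :
    ∫ v : ℝ, Real.exp (A * v - B * v ^ 2) = Real.exp (A ^ 2 / (4 * B)) * √(Real.pi / B) := by
  rw [← integral_gaussian B,
    ← integral_sub_right_eq_self (fun v : ℝ => Real.exp (-B * v ^ 2)) (A / (2 * B)),
    ← integral_const_mul]
  refine integral_congr_ae (Eventually.of_forall fun v => ?_)
  simp only [← Real.exp_add]
  congr 1
  field_simp
  ring

theorem integrable_riemannAuxIntegrand_halfLine {s : ℂ} (hs : 0 ≤ s.re) (m : ℕ) :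
    Integrable fun v => riemannAuxIntegrand s (halfLine m v) := by
  have hπ := Real.pi_pos
  have hg := (integrable_exp_quadratic (B := 2 * Real.pi) (by positivity)
    (-(2 * Real.pi * (m + 1 / 2)))).const_mul
      ((((m : ℝ) + 1 / 2) / √2) ^ (-s.re) * Real.exp (Real.pi * |s.im|))
  refine hg.mono' (continuous_riemannAuxIntegrand_halfLine s m).aestronglyMeasurable
    (Eventually.of_forall fun v => ?_)
  have hpos : 0 < ((m : ℝ) + 1 / 2) / √2 := by positivity
  have hle := half_le_norm_halfLine m v
  have hx : halfLine m v ≠ 0 := norm_pos_iff.1 (hpos.trans_le hle)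
  rw [norm_riemannAuxIntegrand s hx]
  have h2 := two_le_norm_exp_sub_exp_neg_halfLine m v
  refine (div_le_self (by positivity) (by linarith)).trans ?_
  rw [mul_assoc ((((m : ℝ) + 1 / 2) / √2) ^ (-s.re)), ← Real.exp_add]
  have h3 : s.im * (halfLine m v).arg ≤ Real.pi * |s.im| := by
    calc s.im * (halfLine m v).arg ≤ |s.im * (halfLine m v).arg| := le_abs_self _
      _ = |(halfLine m v).arg| * |s.im| := by rw [abs_mul, mul_comm]
      _ ≤ _ := by gcongr; exact Complex.abs_arg_le_pi _
  refine mul_le_mul (Real.rpow_le_rpow_of_nonpos hpos hle (by linarith)) ?_ (by positivity)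
    (by positivity)
  rw [Real.exp_le_exp, halfLine_re, halfLine_im]
  linarith

theorem riemannAux_eq_integral_halfLine (s : ℂ) :
    riemannAux s = -∫ v : ℝ, riemannAuxIntegrand s (halfLine 0 v) * (1 + Complex.I) := by
  have h2 : (0 : ℝ) < √2 := by positivity
  have h2' : ((√2 : ℝ) : ℂ) ≠ 0 := by exact_mod_cast h2.ne'
  have hsq : ((√2 : ℝ) : ℂ) * ((√2 : ℝ) : ℂ) = 2 := by
    rw [← Complex.ofReal_mul, Real.mul_self_sqrt (by norm_num)]; norm_num
  have hexp : Complex.exp (Real.pi * Complex.I / 4) = (1 + Complex.I) / (√2 : ℝ) := by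
    rw [show (Real.pi * Complex.I / 4 : ℂ) = ((Real.pi / 4 : ℝ) : ℂ) * Complex.I by push_cast; ring,
      Complex.exp_mul_I, ← Complex.ofReal_cos, ← Complex.ofReal_sin, Real.cos_pi_div_four,
      Real.sin_pi_div_four]
    push_cast
    field_simp
    linear_combination (1 + Complex.I) * hsq
  have hF := Measure.integral_comp_div
    (fun v : ℝ => riemannAuxIntegrand s (halfLine 0 v) * (1 + Complex.I)) √2
  rw [abs_of_pos h2, Complex.real_smul] at hF
  rw [riemannAux, neg_inj, ← mul_right_inj' h2', ← hF, ← integral_const_mul]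
  refine integral_congr_ae (Eventually.of_forall fun u => ?_)
  have hline : riemannAuxLine u = halfLine 0 (u / √2) := by
    rw [riemannAuxLine, halfLine, hexp]; push_cast; ring
  simp only [hline, hexp]
  field_simp

/-! ### Moving the line across the poles -/

theorem tendsto_exp_neg_quadratic_atTop (K C : ℝ) :
    Tendsto (fun T : ℝ => Real.exp (K - 2 * Real.pi * (T ^ 2 - C * T))) atTop (𝓝 0) := by
  refine Real.tendsto_exp_atBot.comp ?_
  have h1 : Tendsto (fun T : ℝ => T * (T - C)) atTop atTop :=
    tendsto_id.atTop_mul_atTop₀ (tendsto_atTop_add_const_right _ (-C) tendsto_id)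
  have h2 : Tendsto (fun T : ℝ => -(2 * Real.pi * (T * (T - C)))) atTop atBot :=
    tendsto_neg_atTop_atBot.comp (h1.const_mul_atTop (by positivity))
  refine (tendsto_atBot_add_const_left _ K h2).congr fun T => ?_
  ring

/-- Decay of the integrand along lines of slope one near the integer `n`. -/
theorem norm_riemannAuxIntegrand_le_of_two_le {s : ℂ} (hs : 0 ≤ s.re) (n : ℕ) {w : ℂ}
    (him : |w.im| ≤ 1 / 4) (hre : 2 ≤ |w.re|) :
    ‖riemannAuxIntegrand s (n + w * (1 + Complex.I))‖ ≤
      Real.exp (Real.pi * |s.im| + 2 * Real.pi * (n + 1) -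
        2 * Real.pi * (|w.re| ^ 2 - n * |w.re|)) := by
  set x : ℂ := n + w * (1 + Complex.I) with hxdef
  have hxre : x.re = n + w.re - w.im := by simp [hxdef]; ring
  have hxim : x.im = w.re + w.im := by simp [hxdef]
  obtain ⟨hk1, hk2⟩ := abs_le.1 him
  have him1 : 1 ≤ |x.im| := by
    rw [hxim]
    have := abs_sub_abs_le_abs_sub w.re (-w.im)
    rw [abs_neg, sub_neg_eq_add] at this
    linarith
  have hnorm : 1 ≤ ‖x‖ := him1.trans (Complex.abs_im_le_norm x)
  have hx : x ≠ 0 := norm_pos_iff.1 (by linarith)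
  have hden : 1 ≤ ‖Complex.exp (Real.pi * Complex.I * x) -
      Complex.exp (-(Real.pi * Complex.I * x))‖ := by
    refine le_trans ?_ (two_mul_sinh_le_norm_exp_sub_exp_neg x)
    rw [Real.abs_sinh, abs_mul, abs_of_pos Real.pi_pos]
    have h3 : 1 ≤ Real.pi * |x.im| := by nlinarith [Real.pi_gt_three]
    have h4 : Real.pi * |x.im| ≤ Real.sinh (Real.pi * |x.im|) :=
      Real.self_le_sinh_iff.2 (by positivity)
    linarith
  rw [norm_riemannAuxIntegrand s hx]
  refine (div_le_self (by positivity) hden).trans ?_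
  have h1 : ‖x‖ ^ (-s.re) ≤ 1 := Real.rpow_le_one_of_one_le_of_nonpos hnorm (by linarith)
  refine (mul_le_of_le_one_left (by positivity) h1).trans ?_
  rw [Real.exp_le_exp]
  have h3 : s.im * x.arg ≤ Real.pi * |s.im| := by
    calc s.im * x.arg ≤ |s.im * x.arg| := le_abs_self _
      _ = |x.arg| * |s.im| := by rw [abs_mul, mul_comm]
      _ ≤ _ := by gcongr; exact Complex.abs_arg_le_pi _
  have h4 : |w.re| ^ 2 - n * |w.re| - (n + 1) ≤ x.re * x.im := by
    rw [hxre, hxim, sq_abs]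
    have hn : (0 : ℝ) ≤ n := Nat.cast_nonneg n
    nlinarith [mul_nonneg hn (sub_nonneg.2 (neg_abs_le w.re)), sq_nonneg w.im]
  nlinarith [mul_le_mul_of_nonneg_left h4 (by positivity : 0 ≤ 2 * Real.pi)]

theorem exp_pi_mul_I_mul_natCast (n : ℕ) : Complex.exp (Real.pi * Complex.I * n) = (-1) ^ n := by
  rw [mul_comm, Complex.exp_nat_mul, Complex.exp_pi_mul_I]

/-- Moving the line of integration over the pole at `n = m + 1`. -/
theorem integral_halfLine_sub_integral_halfLine {s : ℂ} (hs : 0 ≤ s.re) (m : ℕ) :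
    (∫ v : ℝ, riemannAuxIntegrand s (halfLine (m + 1) v) * (1 + Complex.I)) -
      ∫ v : ℝ, riemannAuxIntegrand s (halfLine m v) * (1 + Complex.I) =
      1 / ((m + 1 : ℕ) : ℂ) ^ s := by
  set n : ℕ := m + 1 with hn
  have hn1 : (1 : ℝ) ≤ n := by exact_mod_cast Nat.succ_le_succ (Nat.zero_le m)
  have h1I : (1 + Complex.I) ≠ 0 := by
    intro h
    have := congrArg Complex.re h
    simp at this
  -- In this coordinate Im w = k is the line of slope one through n − 2k, so the half-integers on
  -- either side of n correspond to k = ±1/4.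
  set X : ℂ → ℂ := fun w => n + w * (1 + Complex.I) with hX
  have hXre : ∀ w, (X w).re = n + w.re - w.im := by intro w; simp [hX]; ring
  have hXim : ∀ w, (X w).im = w.re + w.im := by intro w; simp [hX]
  set Q : ℂ → ℂ := fun w => Complex.exp (Real.pi * Complex.I * X w) -
    Complex.exp (-(Real.pi * Complex.I * X w)) with hQ
  set P : ℂ → ℂ := fun w => X w ^ (-s) * Complex.exp (Real.pi * Complex.I * X w ^ 2) with hP
  set U : Set ℂ := {w | |w.im| < 1 / 2} with hUdef
  have hU : IsOpen U := isOpen_lt (by fun_prop) continuous_const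
  have hX0 : X 0 = n := by simp [hX]
  have hQn : Complex.exp (-(Real.pi * Complex.I * n)) = (-1) ^ n := by
    rw [Complex.exp_neg, exp_pi_mul_I_mul_natCast, ← inv_pow]; norm_num
  have hQ0 : Q 0 = 0 := by simp only [hQ, hX0, exp_pi_mul_I_mul_natCast, hQn, sub_self]
  have hQd : Differentiable ℂ Q := by simp only [hQ, hX]; fun_prop
  have hQ' : deriv Q 0 = 2 * Real.pi * Complex.I * (1 + Complex.I) * (-1) ^ n := by
    have h1 : HasDerivAt (fun w => Real.pi * Complex.I * X w)
        (Real.pi * Complex.I * (1 + Complex.I)) 0 := by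
      have := (((hasDerivAt_id (0 : ℂ)).mul_const (1 + Complex.I)).const_add (n : ℂ)).const_mul
        (Real.pi * Complex.I)
      simpa using this
    have h2 := (h1.cexp.sub h1.neg.cexp).deriv
    simp only [Pi.neg_apply, hX0, exp_pi_mul_I_mul_natCast, hQn] at h2
    refine Eq.trans h2 ?_
    ring
  -- Splitting off the simple zero, Q = w q, writes the integrand as M/w with M = P/q.
  set q : ℂ → ℂ := dslope Q 0 with hq
  have hqQ : ∀ w, w * q w = Q w := by
    intro w
    have := sub_smul_dslope Q 0 w
    simpa [hQ0] using this
  have hqd : DifferentiableOn ℂ q Set.univ :=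
    (Complex.differentiableOn_dslope univ_mem).2 hQd.differentiableOn
  have hq0 : q 0 = 2 * Real.pi * Complex.I * (1 + Complex.I) * (-1) ^ n := by
    rw [hq, dslope_same, hQ']
  have hq0' : q 0 ≠ 0 := by
    rw [hq0]
    have hπ : (Real.pi : ℂ) ≠ 0 := by exact_mod_cast Real.pi_ne_zero
    simp [hπ, h1I]
  -- The zero of Q at x = j has Im w = (n − j)/2, so |Im w| < 1/2 leaves only j = n.
  have hqne : ∀ w ∈ U, q w ≠ 0 := by
    intro w hw h0
    by_cases hw0 : w = 0
    · exact hq0' (hw0 ▸ h0)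
    have hQw : Q w = 0 := by rw [← hqQ, h0, mul_zero]
    have hnorm := normSq_exp_sub_exp_neg (X w)
    have hQw' : Complex.exp (Real.pi * Complex.I * X w) -
        Complex.exp (-(Real.pi * Complex.I * X w)) = 0 := hQw
    rw [hQw', norm_zero] at hnorm
    have hsinh : Real.sinh (Real.pi * (X w).im) = 0 := by
      nlinarith [sq_nonneg (Real.sinh (Real.pi * (X w).im)), sq_nonneg (Real.sin (Real.pi * (X w).re))]
    have hsin : Real.sin (Real.pi * (X w).re) = 0 := by
      nlinarith [sq_nonneg (Real.sinh (Real.pi * (X w).im)), sq_nonneg (Real.sin (Real.pi * (X w).re))]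
    have him : w.re + w.im = 0 := by
      rw [Real.sinh_eq_zero, hXim] at hsinh
      exact (mul_eq_zero.1 hsinh).resolve_left Real.pi_ne_zero
    obtain ⟨j, hj⟩ := Real.sin_eq_zero_iff.1 hsin
    rw [hXre, mul_comm] at hj
    have hj' := mul_left_cancel₀ Real.pi_ne_zero hj
    have h1 : ((j - n : ℤ) : ℝ) = -2 * w.im := by push_cast; linarith
    have hw' : |w.im| < 1 / 2 := hw
    have h2 : |((j - n : ℤ) : ℝ)| < 1 := by
      rw [h1, abs_mul]; norm_num; linarith
    have h3 : (j - n : ℤ) = 0 := by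
      rw [← Int.cast_abs] at h2
      exact Int.abs_lt_one_iff.1 (by exact_mod_cast h2)
    rw [h3] at h1
    apply hw0
    apply Complex.ext <;> simp <;> push_cast at h1 <;> linarith
  set M : ℂ → ℂ := fun w => P w / q w with hM
  have hslit : ∀ w ∈ U, X w ∈ Complex.slitPlane := by
    intro w hw
    have hw' := abs_lt.1 (show |w.im| < 1 / 2 from hw)
    rw [Complex.mem_slitPlane_iff, hXre, hXim]
    by_cases h : w.re + w.im = 0
    · left; linarith
    · right; exact h
  have hMd : DifferentiableOn ℂ M U := by
    refine DifferentiableOn.div ?_ (hqd.mono (Set.subset_univ _)) hqne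
    refine DifferentiableOn.mul ?_ (by simp only [hX]; fun_prop)
    intro w hw
    have hXd : DifferentiableAt ℂ X w := by simp only [hX]; fun_prop
    exact (hXd.cpow (differentiableAt_const _) (hslit w hw)).differentiableWithinAt
  have hMw : ∀ w : ℂ, w ≠ 0 → M w / w = riemannAuxIntegrand s (X w) := by
    intro w hw
    have : riemannAuxIntegrand s (X w) = P w / Q w := rfl
    rw [this, ← hqQ, hM]
    simp only
    rw [div_div, mul_comm w]
  have hM0 : M 0 * (2 * Real.pi * Complex.I) * (1 + Complex.I) = 1 / (n : ℂ) ^ s := by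
    -- n² and n have the same parity, so this sign cancels the one in q 0.
    have hpar : Complex.exp (Real.pi * Complex.I * (n : ℂ) ^ 2) = (-1) ^ n := by
      have := exp_pi_mul_I_mul_natCast (n ^ 2)
      push_cast at this
      rw [this, pow_two, pow_mul]
      rcases Nat.even_or_odd n with h | h
      · simp [h.neg_one_pow]
      · simp [h.neg_one_pow]
    simp only [hM, hP, hX0, hq0, hpar, Complex.cpow_neg]
    have hπ : (Real.pi : ℂ) ≠ 0 := by exact_mod_cast Real.pi_ne_zero
    have h3 : ((-1 : ℂ)) ^ n ≠ 0 := pow_ne_zero _ (by norm_num)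
    field_simp
  have hline : ∀ (k v : ℝ) (j : ℕ), (n : ℝ) - 2 * k = j + 1 / 2 →
      X (v + k * Complex.I) = halfLine j (v + k) := by
    intro k v j hj
    apply Complex.ext
    · rw [hXre, halfLine_re]; simp; linarith
    · rw [hXim, halfLine_im]; simp
  have hne : ∀ (x y : ℝ), y ≠ 0 → (x : ℂ) + y * Complex.I ≠ 0 := by
    intro x y hy h0
    have := congrArg Complex.im h0
    simp at this
    exact hy this
  have hfun : ∀ (k : ℝ) (j : ℕ), k ≠ 0 → (n : ℝ) - 2 * k = j + 1 / 2 →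
      (fun v : ℝ => M (v + k * Complex.I) / (v + k * Complex.I)) =
        fun v : ℝ => riemannAuxIntegrand s (halfLine j (v + k)) := by
    intro k j hk hj
    funext v
    rw [hMw _ (hne v k hk), hline k v j hj]
  have hf₁ := hfun (-(1 / 4)) n (by norm_num) (by ring)
  have hf₂ := hfun (1 / 4) m (by norm_num) (by rw [hn]; push_cast; ring)
  have key := integral_strip_sub_integral_strip (M := M) (b := 1 / 4) (T₀ := 2) (by norm_num) hU
    (fun w hw => lt_of_le_of_lt hw (by norm_num)) hMd
    (tendsto_exp_neg_quadratic_atTop (Real.pi * |s.im| + 2 * Real.pi * (n + 1)) n)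
    (fun w hw hw2 => by
      have hw0 : w ≠ 0 := by rintro rfl; simp at hw2; linarith
      rw [hMw w hw0]
      exact norm_riemannAuxIntegrand_le_of_two_le hs n hw hw2)
    (by rw [hf₁]; exact (integrable_riemannAuxIntegrand_halfLine hs n).comp_add_right _)
    (by rw [hf₂]; exact (integrable_riemannAuxIntegrand_halfLine hs m).comp_add_right _)
  rw [hf₁, hf₂, integral_add_right_eq_self (fun v => riemannAuxIntegrand s (halfLine n v)),
    integral_add_right_eq_self (fun v => riemannAuxIntegrand s (halfLine m v))] at key
  rw [integral_mul_const, integral_mul_const, ← sub_mul, key, ← hM0]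
  ring

theorem riemannAux_sub_sum {s : ℂ} (hs : 0 ≤ s.re) (N : ℕ) :
    riemannAux s - ∑ n ∈ Finset.Icc 1 N, 1 / (n : ℂ) ^ s =
      -∫ v : ℝ, riemannAuxIntegrand s (halfLine N v) * (1 + Complex.I) := by
  induction N with
  | zero => simp [riemannAux_eq_integral_halfLine]
  | succ m ih =>
    rw [Finset.sum_Icc_succ_top (by omega), ← sub_sub, ih,
      ← integral_halfLine_sub_integral_halfLine hs m]
    ring

/-! ### Polynomial bounds for arctan and log -/

theorem le_of_hasDerivAt_nonneg {f f' : ℝ → ℝ} {x y : ℝ} (hxy : x ≤ y)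
    (hf : ∀ z ∈ Set.Icc x y, HasDerivAt f (f' z) z) (hf' : ∀ z ∈ Set.Icc x y, 0 ≤ f' z) :
    f x ≤ f y := by
  refine monotoneOn_of_deriv_nonneg (convex_Icc x y)
    (fun z hz => (hf z hz).continuousAt.continuousWithinAt)
    (fun z hz => (hf z (interior_subset hz)).differentiableAt.differentiableWithinAt)
    (fun z hz => ?_) (Set.left_mem_Icc.2 hxy) (Set.right_mem_Icc.2 hxy) hxy
  rw [(hf z (interior_subset hz)).deriv]
  exact hf' z (interior_subset hz)

theorem one_add_two_mul_add_pos (z : ℝ) : 0 < 1 + 2 * z + 2 * z ^ 2 := by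
  nlinarith [sq_nonneg (1 + 2 * z)]

theorem hasDerivAt_arctan_div {z : ℝ} (hz : -1 < z) :
    HasDerivAt (fun z : ℝ => Real.arctan (z / (1 + z))) (1 / (1 + 2 * z + 2 * z ^ 2)) z := by
  have h0 : 1 + z ≠ 0 := by linarith
  have h1 : HasDerivAt (fun z : ℝ => z / (1 + z)) ((1 * (1 + z) - z * 1) / (1 + z) ^ 2) z :=
    (hasDerivAt_id z).div ((hasDerivAt_id z).const_add 1) h0
  convert h1.arctan using 1
  have h2 := one_add_two_mul_add_pos z
  have h3 : 1 + (z / (1 + z)) ^ 2 = (1 + 2 * z + 2 * z ^ 2) / (1 + z) ^ 2 := by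
    field_simp; ring
  rw [h3]
  field_simp
  ring

/-- The derivatives compare because (1 − 2y + 2y²)(1 + 2y + 2y²) = 1 + 4y⁴ ≥ 1. -/
theorem arctan_div_le_cubic {z : ℝ} (hz : 0 ≤ z) :
    Real.arctan (z / (1 + z)) ≤ z - z ^ 2 + 2 / 3 * z ^ 3 := by
  have := le_of_hasDerivAt_nonneg (f := fun z => z - z ^ 2 + 2 / 3 * z ^ 3 -
    Real.arctan (z / (1 + z))) (f' := fun z => 1 - 2 * z + 2 * z ^ 2 - 1 / (1 + 2 * z + 2 * z ^ 2))
    hz ?_ ?_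
  · simp at this
    linarith
  · intro y hy
    have h1 := (((hasDerivAt_id y).sub (hasDerivAt_pow 2 y)).add
      ((hasDerivAt_pow 3 y).const_mul (2 / 3))).sub (hasDerivAt_arctan_div (z := y) (by linarith [hy.1]))
    refine h1.congr_deriv ?_
    norm_num
    ring
  · intro y hy
    have := one_add_two_mul_add_pos y
    rw [sub_nonneg, div_le_iff₀ this]
    nlinarith [sq_nonneg (y ^ 2)]

/-- The derivatives compare because (1 − 3y/2)(1 + 2y + 2y²) = 1 + y(1/2 − y − 3y²) ≤ 1 on [−1/2,
0]. -/
theorem arctan_div_le_of_nonpos {z : ℝ} (hz : -1 / 2 ≤ z) (hz0 : z ≤ 0) :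
    Real.arctan (z / (1 + z)) ≤ z - 3 / 4 * z ^ 2 := by
  have := le_of_hasDerivAt_nonneg (f := fun z => Real.arctan (z / (1 + z)) - (z - 3 / 4 * z ^ 2))
    (f' := fun z => 1 / (1 + 2 * z + 2 * z ^ 2) - (1 - 3 / 2 * z)) hz0 ?_ ?_
  · simp at this
    linarith
  · intro y hy
    have h1 := (hasDerivAt_arctan_div (z := y) (by linarith [hy.1])).sub
      ((hasDerivAt_id y).sub ((hasDerivAt_pow 2 y).const_mul (3 / 4)))
    refine h1.congr_deriv ?_
    norm_num
    ring
  · intro y hy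
    have h1 := one_add_two_mul_add_pos y
    have h2 : -1 / 2 ≤ y := by linarith [hy.1]
    rw [sub_nonneg, le_div_iff₀ h1]
    nlinarith [mul_nonneg (neg_nonneg.2 hy.2) (by nlinarith [hy.2] : 0 ≤ 1 / 2 - y - 3 * y ^ 2)]

/-- The limit 3/8 is where the cubic term 2z³/3 stops being absorbed by z²/4; it fixes the right end
of the central range. -/
theorem arctan_div_le_quadratic {z : ℝ} (hz : -1 / 2 ≤ z) (hz1 : z ≤ 3 / 8) :
    Real.arctan (z / (1 + z)) ≤ z - 3 / 4 * z ^ 2 := by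
  rcases le_total z 0 with h | h
  · exact arctan_div_le_of_nonpos hz h
  · nlinarith [arctan_div_le_cubic h, mul_nonneg (sq_nonneg z) (sub_nonneg.2 hz1)]

/-- 0.2696 rounds up the cubic bound at 3/8, and the slope 1/2 rounds up the derivative 32/65 there,
which only decreases afterwards. -/
theorem arctan_div_le_linear {z : ℝ} (hz : 3 / 8 ≤ z) :
    Real.arctan (z / (1 + z)) ≤ 0.2696 + (z - 3 / 8) / 2 := by
  have := le_of_hasDerivAt_nonneg (f := fun z => z / 2 - Real.arctan (z / (1 + z)))
    (f' := fun z => 1 / 2 - 1 / (1 + 2 * z + 2 * z ^ 2)) hz ?_ ?_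
  · have h1 := arctan_div_le_cubic (z := 3 / 8) (by norm_num)
    norm_num at h1 this ⊢
    linarith
  · intro y hy
    exact ((hasDerivAt_id y).div_const 2).sub (hasDerivAt_arctan_div (z := y) (by linarith [hy.1]))
  · intro y hy
    have h1 := one_add_two_mul_add_pos y
    rw [sub_nonneg, div_le_iff₀ h1]
    nlinarith [hy.1]

/-- The difference of the sides vanishes at 0 and its derivative has the sign of y(1 − y)(1 − 2y),
so 0 is its minimum on z ≤ 1/2. -/
theorem two_mul_sub_le_log {z : ℝ} (hz1 : z ≤ 1 / 2) :
    2 * z - 2 / 5 * z ^ 2 ≤ Real.log (1 + 2 * z + 2 * z ^ 2) := by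
  have hd : ∀ y : ℝ, HasDerivAt (fun z => Real.log (1 + 2 * z + 2 * z ^ 2) - (2 * z - 2 / 5 * z ^ 2))
      ((2 + 4 * y) / (1 + 2 * y + 2 * y ^ 2) - (2 - 4 / 5 * y)) y := by
    intro y
    have h1 := ((((hasDerivAt_id y).const_mul 2).const_add 1).add
      ((hasDerivAt_pow 2 y).const_mul 2)).log (one_add_two_mul_add_pos y).ne'
    have h2 := h1.sub (((hasDerivAt_id y).const_mul 2).sub ((hasDerivAt_pow 2 y).const_mul (2 / 5)))
    refine h2.congr_deriv ?_
    norm_num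
    ring
  have hval : ∀ y : ℝ, (2 + 4 * y) / (1 + 2 * y + 2 * y ^ 2) - (2 - 4 / 5 * y) =
      4 / 5 * y * (1 - y) * (1 - 2 * y) / (1 + 2 * y + 2 * y ^ 2) := by
    intro y
    have := (one_add_two_mul_add_pos y).ne'
    field_simp
    ring
  rcases le_total 0 z with h | h
  · have := le_of_hasDerivAt_nonneg h (fun y _ => hd y) ?_
    · simp at this
      linarith
    · intro y hy
      rw [hval]
      have h1 := one_add_two_mul_add_pos y
      have h2 : 0 ≤ 1 - y := by linarith [hy.2]
      have h3 : 0 ≤ 1 - 2 * y := by linarith [hy.2]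
      have h4 := hy.1
      positivity
  · have := le_of_hasDerivAt_nonneg h (fun y _ => (hd y).neg) ?_
    · simp at this
      linarith
    · intro y hy
      rw [hval, ← neg_div]
      have h1 := one_add_two_mul_add_pos y
      refine div_nonneg ?_ h1.le
      have h2 : 0 ≤ 1 - y := by linarith [hy.2]
      have h3 : 0 ≤ 1 - 2 * y := by linarith [hy.2]
      have h4 : 0 ≤ -y := by linarith [hy.2]
      have := mul_nonneg (mul_nonneg h4 h2) h3
      nlinarith

/-! ### Phase and modulus on the line through c -/

theorem arg_eq_arctan_of_re_pos {x : ℂ} (hx : 0 < x.re) : x.arg = Real.arctan (x.im / x.re) := by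
  have h := abs_lt.1 (Complex.abs_arg_lt_pi_div_two_iff.2 (Or.inl hx))
  rw [← Complex.tan_arg, Real.arctan_tan h.1 h.2]

theorem arg_le_neg_pi_div_four {x : ℂ} (him : x.im < 0) (h : x.re ≤ -x.im) :
    x.arg ≤ -(Real.pi / 4) := by
  rcases le_or_gt x.re 0 with hre | hre
  · have : ¬ (-(Real.pi / 2) < x.arg) := by
      rw [Complex.neg_pi_div_two_lt_arg_iff]
      push Not
      exact ⟨hre, him⟩
    linarith [Real.pi_pos]
  · rw [arg_eq_arctan_of_re_pos hre, ← Real.arctan_one, ← Real.arctan_neg]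
    refine Real.arctan_mono ?_
    rw [div_le_iff₀ hre]
    linarith

section halfLine

variable {m : ℕ} {v c : ℝ}

theorem arg_halfLine (hc : c = m + 1 / 2) (hv : -c < v) :
    (halfLine m v).arg = Real.arctan ((v / c) / (1 + v / c)) := by
  have hc0 : 0 < c := by rw [hc]; positivity
  have hre : (halfLine m v).re = c + v := by rw [halfLine_re, hc]
  rw [arg_eq_arctan_of_re_pos (by rw [hre]; linarith), hre, halfLine_im]
  congr 1
  have : c + v ≠ 0 := by linarith
  have : 1 + v / c ≠ 0 := by
    rw [← div_self hc0.ne', ← add_div]; positivity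
  field_simp

theorem norm_halfLine (hc : c = m + 1 / 2) :
    ‖halfLine m v‖ = c * √(1 + 2 * (v / c) + 2 * (v / c) ^ 2) := by
  have hc0 : 0 < c := by rw [hc]; positivity
  rw [← Real.sqrt_sq (norm_nonneg _), norm_halfLine_sq, ← hc]
  nth_rewrite 2 [← Real.sqrt_sq hc0.le]
  rw [← Real.sqrt_mul (sq_nonneg c)]
  congr 1
  field_simp
  ring

variable {a : ℝ}

/-- The phase on the central part of the line, bounded by a quadratic polynomial. -/
theorem phase_le_quadratic (hc : c = m + 1 / 2) (hv : -(c / 2) ≤ v) (hv' : v ≤ 3 / 8 * c) :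
    a ^ 2 * (halfLine m v).arg - c * v - v ^ 2 ≤
      (a ^ 2 - c ^ 2) / c * v - (1 + 3 / 4 * (a / c) ^ 2) * v ^ 2 := by
  have hc0 : 0 < c := by rw [hc]; positivity
  rw [arg_halfLine hc (by linarith)]
  have h := arctan_div_le_quadratic (z := v / c) (by rw [le_div_iff₀ hc0]; linarith)
    (by rw [div_le_iff₀ hc0]; linarith)
  have h2 := mul_le_mul_of_nonneg_left h (sq_nonneg a)
  have h3 : a ^ 2 * (v / c - 3 / 4 * (v / c) ^ 2) - c * v - v ^ 2 =
      (a ^ 2 - c ^ 2) / c * v - (1 + 3 / 4 * (a / c) ^ 2) * v ^ 2 := by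
    field_simp
    ring
  linarith

theorem phase_le_linear (hc : c = m + 1 / 2) (hv : 3 / 8 * c ≤ v) :
    a ^ 2 * (halfLine m v).arg - c * v - v ^ 2 ≤
      -(0.515625 * c ^ 2 - 0.2696 * a ^ 2) - (1.75 * c ^ 2 - a ^ 2 / 2) / c * (v - 3 / 8 * c) := by
  have hc0 : 0 < c := by rw [hc]; positivity
  rw [arg_halfLine hc (by nlinarith)]
  have h := arctan_div_le_linear (z := v / c) (by rw [le_div_iff₀ hc0]; linarith)
  have h2 := mul_le_mul_of_nonneg_left h (sq_nonneg a)
  -- Expansion about v = 3c/8: 0.515625 = 3/8 + 9/64 and 1.75 = 1 + 2·3/8. The last square is then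
  -- dropped.
  have h3 : a ^ 2 * (0.2696 + (v / c - 3 / 8) / 2) - c * v - v ^ 2 =
      -(0.515625 * c ^ 2 - 0.2696 * a ^ 2) - (1.75 * c ^ 2 - a ^ 2 / 2) / c * (v - 3 / 8 * c)
        - (v - 3 / 8 * c) ^ 2 := by
    field_simp
    ring
  nlinarith [sq_nonneg (v - 3 / 8 * c)]

/-- For v ≤ −c/2 one has Re x ≤ −Im x, hence arg x ≤ −π/4; completing the square in −cv − v² does
the rest. -/
theorem phase_le_of_le_neg_half (hc : c = m + 1 / 2) (hv : v ≤ -(c / 2)) :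
    a ^ 2 * (halfLine m v).arg - c * v - v ^ 2 ≤
      -(Real.pi / 4 * a ^ 2 - c ^ 2 / 4) - (v + c / 2) ^ 2 := by
  have hc0 : 0 < c := by rw [hc]; positivity
  have h := arg_le_neg_pi_div_four (x := halfLine m v) (by rw [halfLine_im]; linarith)
    (by rw [halfLine_re, halfLine_im, ← hc]; linarith)
  nlinarith [mul_le_mul_of_nonneg_left h (sq_nonneg a)]

/-- Puts the weight 1/‖x‖ in Gaussian form, so that σ = 1 merely changes the coefficients of the
central quadratic. -/
theorem inv_norm_halfLine_le_exp (hc : c = m + 1 / 2) (hv' : v ≤ 3 / 8 * c) :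
    1 / ‖halfLine m v‖ ≤ 1 / c * Real.exp (-(v / c) + 1 / 5 * (v / c) ^ 2) := by
  have hc0 : 0 < c := by rw [hc]; positivity
  have h := two_mul_sub_le_log (z := v / c)
    (by rw [div_le_iff₀ hc0]; linarith)
  have hpos := one_add_two_mul_add_pos (v / c)
  have h1 : Real.exp (v / c - 1 / 5 * (v / c) ^ 2) ≤ √(1 + 2 * (v / c) + 2 * (v / c) ^ 2) := by
    refine Real.le_sqrt_of_sq_le ?_
    rw [← Real.exp_nat_mul, ← Real.le_log_iff_exp_le hpos]
    push_cast
    linarith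
  rw [norm_halfLine hc, one_div, mul_inv, ← one_div c,
    show -(v / c) + 1 / 5 * (v / c) ^ 2 = -(v / c - 1 / 5 * (v / c) ^ 2) by ring, Real.exp_neg]
  gcongr

end halfLine

/-! ### Gaussian majorants with tails -/

theorem integrable_indicator_exp {k : ℝ} (hk : 0 < k) (b : ℝ) :
    Integrable ((Set.Ioi b).indicator fun v => Real.exp (-k * (v - b))) := by
  rw [integrable_indicator_iff measurableSet_Ioi]
  refine ((integrableOn_exp_mul_Ioi (neg_lt_zero.2 hk) b).const_mul (Real.exp (k * b))).congr
    (Eventually.of_forall fun v => ?_)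
  simp only [← Real.exp_add]
  ring_nf

theorem integral_indicator_exp {k : ℝ} (hk : 0 < k) (b : ℝ) :
    ∫ v, (Set.Ioi b).indicator (fun v => Real.exp (-k * (v - b))) v = 1 / k := by
  rw [integral_indicator measurableSet_Ioi]
  have h : ∀ v : ℝ, Real.exp (-k * (v - b)) = Real.exp (k * b) * Real.exp (-k * v) := by
    intro v
    rw [← Real.exp_add]
    ring_nf
  simp_rw [h]
  rw [integral_const_mul, integral_exp_mul_Ioi (neg_lt_zero.2 hk), neg_div_neg_eq, ← mul_div_assoc,
    ← Real.exp_add]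
  ring_nf
  simp

theorem integrable_indicator_gaussian {k : ℝ} (hk : 0 < k) (b : ℝ) :
    Integrable ((Set.Iic b).indicator fun v => Real.exp (-k * (v - b) ^ 2)) :=
  ((integrable_exp_neg_mul_sq hk).comp_sub_right b).indicator measurableSet_Iic

theorem integral_indicator_gaussian (k b : ℝ) :
    ∫ v, (Set.Iic b).indicator (fun v => Real.exp (-k * (v - b) ^ 2)) v = √(Real.pi / k) / 2 := by
  have h : ∀ v : ℝ, (Set.Iic b).indicator (fun v => Real.exp (-k * (v - b) ^ 2)) v =
      (Set.Iic (0 : ℝ)).indicator (fun v => Real.exp (-k * v ^ 2)) (v - b) := by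
    intro v
    by_cases hv : v ≤ b <;> simp [Set.indicator, hv]
  simp_rw [h]
  rw [integral_sub_right_eq_self (fun v => (Set.Iic (0 : ℝ)).indicator
      (fun v => Real.exp (-k * v ^ 2)) v), integral_indicator measurableSet_Iic,
    ← integral_gaussian_Ioi]
  have := integral_comp_neg_Iic (0 : ℝ) (fun v => Real.exp (-k * v ^ 2))
  simpa using this

/-- A majorant that is Gaussian in the middle and has explicit tails. -/
theorem exists_integrable_majorant {F : ℝ → ℝ} {b₁ b₂ R A B C₁ k₁ C₂ k₂ : ℝ} (hB : 0 < B)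
    (hR : 0 ≤ R) (hC₁ : 0 ≤ C₁) (hC₂ : 0 ≤ C₂) (hk₁ : 0 < k₁) (hk₂ : 0 < k₂)
    (hmid : ∀ v, b₂ ≤ v → v ≤ b₁ → F v ≤ R * Real.exp (A * v - B * v ^ 2))
    (hright : ∀ v, b₁ < v → F v ≤ C₁ * Real.exp (-k₁ * (v - b₁)))
    (hleft : ∀ v, v ≤ b₂ → F v ≤ C₂ * Real.exp (-k₂ * (v - b₂) ^ 2)) :
    ∃ g : ℝ → ℝ, Integrable g ∧ (∀ v, F v ≤ g v) ∧
      ∫ v, g v = R * (Real.exp (A ^ 2 / (4 * B)) * √(Real.pi / B)) + C₁ * (1 / k₁) +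
        C₂ * (√(Real.pi / k₂) / 2) := by
  have i₀ := (integrable_exp_quadratic hB A).const_mul R
  have i₁ := (integrable_indicator_exp hk₁ b₁).const_mul C₁
  have i₂ := (integrable_indicator_gaussian hk₂ b₂).const_mul C₂
  refine ⟨_, (i₀.add i₁).add i₂, fun v => ?_, ?_⟩
  · simp only [Pi.add_apply]
    have p₀ : 0 ≤ R * Real.exp (A * v - B * v ^ 2) := by positivity
    have p₁ : 0 ≤ C₁ * (Set.Ioi b₁).indicator (fun v => Real.exp (-k₁ * (v - b₁))) v :=
      mul_nonneg hC₁ (Set.indicator_nonneg (fun _ _ => by positivity) _)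
    have p₂ : 0 ≤ C₂ * (Set.Iic b₂).indicator (fun v => Real.exp (-k₂ * (v - b₂) ^ 2)) v :=
      mul_nonneg hC₂ (Set.indicator_nonneg (fun _ _ => by positivity) _)
    rcases le_or_gt v b₂ with h | h
    · have := hleft v h
      rw [Set.indicator_of_mem (show v ∈ Set.Iic b₂ from h)]
      linarith
    · rcases le_or_gt v b₁ with h' | h'
      · linarith [hmid v h.le h']
      · have := hright v h'
        rw [Set.indicator_of_mem (show v ∈ Set.Ioi b₁ from h')]
        linarith
  · rw [integral_add' (i₀.add i₁) i₂, integral_add' i₀ i₁, integral_const_mul, integral_const_mul,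
      integral_const_mul, integral_exp_quadratic hB, integral_indicator_exp hk₁,
      integral_indicator_gaussian]

/-- Squaring removes the root, leaving numerics that involve only exp and rational functions. -/
theorem mul_exp_mul_sqrt_le {R A B y : ℝ} (hB : 0 < B) (hy : 0 ≤ y)
    (h : R ^ 2 * (Real.exp (A ^ 2 / (2 * B)) * (Real.pi / B)) ≤ y ^ 2) :
    R * (Real.exp (A ^ 2 / (4 * B)) * √(Real.pi / B)) ≤ y := by
  refine le_of_pow_le_pow_left₀ two_ne_zero hy (le_trans (le_of_eq ?_) h)
  have hπ := Real.pi_pos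
  rw [mul_pow, mul_pow, Real.sq_sqrt (by positivity), ← Real.exp_nat_mul]
  congr 3
  push_cast
  field_simp
  ring

/-! ### Numerical estimates -/

theorem exp_le_of_le_one_point_eight {x : ℝ} (hx : x ≤ 1.8109) : Real.exp x ≤ 6.117 := by
  refine (Real.exp_le_exp.2 hx).trans ?_
  have h : Real.exp (1.8109 / 2) ≤ 2.47325 := by
    refine (Real.exp_bound' (by norm_num) (by norm_num) (n := 10) (by norm_num)).trans ?_
    norm_num [Finset.sum_range_succ, Nat.factorial]
  have h2 : Real.exp 1.8109 = Real.exp (1.8109 / 2) ^ 2 := by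
    rw [← Real.exp_nat_mul]; norm_num
  rw [h2]
  nlinarith [Real.exp_pos (1.8109 / 2)]

theorem exp_le_of_le_one_point_eighty_four {x : ℝ} (hx : x ≤ 1.841) : Real.exp x ≤ 6.31 := by
  have h := exp_le_of_le_one_point_eight (x := 1.8109) le_rfl
  have h2 : Real.exp 0.0301 ≤ 1.0306 := by
    refine (Real.exp_bound' (by norm_num) (by norm_num) (n := 4) (by norm_num)).trans ?_
    norm_num [Finset.sum_range_succ, Nat.factorial]
  calc Real.exp x ≤ Real.exp (1.8109 + 0.0301) := Real.exp_le_exp.2 (by linarith)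
    _ = Real.exp 1.8109 * Real.exp 0.0301 := Real.exp_add _ _
    _ ≤ 6.117 * 1.0306 := by gcongr
    _ ≤ 6.31 := by norm_num

/-- Trades e^{-y} for 1/(1 + y + y²/2), which turns the estimates below into polynomial inequalities
in δ. -/
theorem exp_mul_quadratic_le {x y : ℝ} (hy : 0 ≤ y) (hx : x ≤ 1.8109 - y) :
    Real.exp x * (1 + y + y ^ 2 / 2) ≤ 6.117 := by
  have h1 := Real.quadratic_le_exp_of_nonneg hy
  calc Real.exp x * (1 + y + y ^ 2 / 2) ≤ Real.exp (1.8109 - y) * Real.exp y := by gcongr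
    _ = Real.exp 1.8109 := by rw [← Real.exp_add]; ring_nf
    _ ≤ 6.117 := exp_le_of_le_one_point_eight le_rfl

/-- Main Gaussian term without the factor `a / ‖x‖`, where `a = c (1 + δ)`. -/
theorem gaussian_term_zero_le {c δ : ℝ} (hδ : -0.2 ≤ δ) (h : |c * δ| ≤ 1 / 2) :
    Real.exp (Real.pi * (c * δ * (2 + δ)) ^ 2 / (1 + 3 / 4 * (1 + δ) ^ 2)) /
        (2 * (1 + 3 / 4 * (1 + δ) ^ 2)) ≤ if 0 ≤ δ then 1.85 else 1.9656 := by
  have hd : (c * δ) ^ 2 ≤ 1 / 4 := by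
    rw [← sq_abs]; nlinarith [abs_nonneg (c * δ)]
  have hp : (c * δ * (2 + δ)) ^ 2 ≤ 1 / 4 * (2 + δ) ^ 2 := by
    rw [mul_pow]; gcongr
  have hB : 0 < 1 + 3 / 4 * (1 + δ) ^ 2 := by positivity
  have hπ := Real.pi_pos
  have hπ1 := Real.pi_lt_d4
  have hπ2 := Real.pi_gt_d4
  split_ifs with h0
  -- With |cδ| ≤ 1/2 the ratio is at most 7/12, reached at δ = 1/3; 0.5858 leaves some room.
  · have hq : (c * δ * (2 + δ)) ^ 2 / (1 + 3 / 4 * (1 + δ) ^ 2) ≤ 0.5858 := by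
      rw [div_le_iff₀ hB]
      nlinarith [sq_nonneg (δ - 0.32)]
    have he := exp_le_of_le_one_point_eighty_four
      (x := Real.pi * (c * δ * (2 + δ)) ^ 2 / (1 + 3 / 4 * (1 + δ) ^ 2))
      (by rw [mul_div_assoc]; nlinarith)
    rw [div_le_iff₀ (by positivity)]
    nlinarith
  · push Not at h0
    have hq : (c * δ * (2 + δ)) ^ 2 / (1 + 3 / 4 * (1 + δ) ^ 2) ≤ 4 / 7 + 0.08 * δ := by
      rw [div_le_iff₀ hB]
      nlinarith [mul_nonneg (sq_nonneg δ) (by linarith : 0 ≤ δ + 0.2)]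
    -- This y fits π(4/7 + 0.08δ) below 1.8109 − y: 4π/7 < 1.8109 − 0.0156, and 0.08π > 0.25 with δ
    -- < 0.
    have he := exp_mul_quadratic_le
      (x := Real.pi * (c * δ * (2 + δ)) ^ 2 / (1 + 3 / 4 * (1 + δ) ^ 2))
      (y := 0.0156 - 0.25 * δ) (by linarith) (by rw [mul_div_assoc]; nlinarith)
    rw [div_le_iff₀ (by positivity)]
    set E := Real.exp (Real.pi * (c * δ * (2 + δ)) ^ 2 / (1 + 3 / 4 * (1 + δ) ^ 2)) with hE
    have hE0 : 0 < E := Real.exp_pos _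
    have hy : 0 < 1.0156 - 0.25 * δ := by linarith
    have h1 : E * (1.0156 - 0.25 * δ) ≤ 6.117 := by nlinarith [sq_nonneg (0.0156 - 0.25 * δ)]
    have h2 : 6.117 ≤ 1.9656 * (2 * (1 + 3 / 4 * (1 + δ) ^ 2)) * (1.0156 - 0.25 * δ) := by
      nlinarith [mul_nonneg (by linarith : 0 ≤ -δ) (by linarith : 0 ≤ δ + 0.2),
        mul_nonneg (mul_nonneg (by linarith : 0 ≤ -δ) (by linarith : 0 ≤ -δ)) (by linarith : 0 ≤ -δ)]
    exact le_of_mul_le_mul_right (h1.trans h2) hy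

theorem sq_mul_gaussian_le_of_nonneg {δ A B : ℝ} (h0 : 0 ≤ δ) (hδ : δ ≤ 1 / 3)
    (hA : A ^ 2 ≤ (1 + 0.182 * δ) ^ 2) (hB : 1.7358 + 1.5 * δ + 0.75 * δ ^ 2 ≤ B) :
    (1 + δ) ^ 2 * (Real.exp (Real.pi * A ^ 2 / B) / (2 * B)) ≤ 1.85 := by
  have hπ1 := Real.pi_lt_d4
  have hπ2 := Real.pi_gt_d4
  have hB0 : 0 < B := lt_of_lt_of_le (by positivity) hB
  have hq : A ^ 2 / B ≤ 0.5764 - 0.27 * δ := by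
    rw [div_le_iff₀ hB0]
    refine hA.trans (le_trans ?_ (mul_le_mul_of_nonneg_left hB (by linarith)))
    have h3 : 0 ≤ δ * (1 / 3 - δ) := mul_nonneg h0 (by linarith)
    nlinarith [mul_nonneg h3 h0]
  have hx : Real.pi * A ^ 2 / B ≤ 1.8109 - 0.848 * δ := by
    rw [mul_div_assoc]
    calc Real.pi * (A ^ 2 / B) ≤ Real.pi * (0.5764 - 0.27 * δ) := by gcongr
      _ ≤ _ := by nlinarith
  have he := exp_mul_quadratic_le (by positivity) hx
  have hy : 0 < 1 + 0.848 * δ + (0.848 * δ) ^ 2 / 2 := by positivity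
  have hpoly : (1 + δ) ^ 2 * 6.117 ≤ 1.85 * (2 * (1.7358 + 1.5 * δ + 0.75 * δ ^ 2)) *
      (1 + 0.848 * δ + (0.848 * δ) ^ 2 / 2) := by
    nlinarith only [pow_nonneg h0 3, pow_nonneg h0 4, sq_nonneg (δ - 0.1685)]
  rw [← mul_div_assoc, div_le_iff₀ (by positivity)]
  refine le_of_mul_le_mul_right ?_ hy
  rw [mul_assoc ((1 + δ) ^ 2)]
  calc _ ≤ (1 + δ) ^ 2 * 6.117 := by gcongr
    _ ≤ _ := hpoly
    _ ≤ _ := by gcongr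

/-- As δ = −e decreases, the exponent may grow by 0.531πe, but (1+δ)² ≤ e^{2δ} takes back 2e,
leaving the decay 0.331e. -/
theorem sq_mul_gaussian_le_of_nonpos {δ A B : ℝ} (h0 : δ ≤ 0) (hδ : -0.2 ≤ δ)
    (hA : A ^ 2 ≤ 1) (hB : 1.7358 + 1.5 * δ + 0.75 * δ ^ 2 ≤ B) :
    (1 + δ) ^ 2 * (Real.exp (Real.pi * A ^ 2 / B) / (2 * B)) ≤ 1.9656 := by
  have hπ1 := Real.pi_lt_d4
  have hπ2 := Real.pi_gt_d4
  have hB0 : 0 < B := by nlinarith only [sq_nonneg δ, hB, hδ]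
  obtain ⟨e, rfl⟩ : ∃ e, δ = -e := ⟨-δ, by ring⟩
  have h0' : 0 ≤ e := by linarith
  have hq : A ^ 2 / B ≤ 0.5763 + 0.531 * e := by
    rw [div_le_iff₀ hB0]
    refine hA.trans (le_trans ?_ (mul_le_mul_of_nonneg_left hB (by positivity)))
    have h3 : 0 ≤ e * (0.2 - e) := mul_nonneg h0' (by linarith)
    nlinarith only [mul_nonneg h3 h0', h3, h0', hδ]
  have hr : (1 + -e) ^ 2 ≤ Real.exp (2 * -e) := by
    rw [two_mul, Real.exp_add, ← pow_two]
    have := Real.add_one_le_exp (-e)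
    exact pow_le_pow_left₀ (by linarith) (by linarith) 2
  have hx : 2 * -e + Real.pi * A ^ 2 / B ≤ 1.8109 - 0.331 * e := by
    rw [mul_div_assoc]
    calc 2 * -e + Real.pi * (A ^ 2 / B) ≤ 2 * -e + Real.pi * (0.5763 + 0.531 * e) := by gcongr
      _ ≤ _ := by nlinarith only [hπ1, hπ2, h0', hδ]
  have he := exp_mul_quadratic_le (by positivity) hx
  rw [Real.exp_add] at he
  have hy : 0 < 1 + 0.331 * e + (0.331 * e) ^ 2 / 2 := by positivity
  have hpoly : 6.117 ≤ 1.9656 * (2 * (1.7358 + 1.5 * -e + 0.75 * (-e) ^ 2)) *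
      (1 + 0.331 * e + (0.331 * e) ^ 2 / 2) := by
    have h3 : 0 ≤ e * (0.2 - e) := mul_nonneg h0' (by linarith)
    nlinarith only [mul_nonneg h3 h0', h3, h0', hδ, pow_nonneg h0' 4]
  rw [← mul_div_assoc, div_le_iff₀ (by positivity)]
  refine le_of_mul_le_mul_right ?_ hy
  calc _ ≤ Real.exp (2 * -e) * Real.exp (Real.pi * A ^ 2 / B) *
        (1 + 0.331 * e + (0.331 * e) ^ 2 / 2) := by gcongr
    _ ≤ 6.117 := he
    _ ≤ _ := hpoly
    _ ≤ _ := by gcongr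

/-- Main Gaussian term with the factor `a / ‖x‖`, where `a = c (1 + δ)`. -/
theorem gaussian_term_one_le {c δ : ℝ} (hc : 3 / 2 ≤ c) (hδ : -0.2 ≤ δ) (h : |c * δ| ≤ 1 / 2) :
    0 < 1 + 3 / 4 * (1 + δ) ^ 2 - 1 / (10 * Real.pi * c ^ 2) ∧
    (1 + δ) ^ 2 * (Real.exp (Real.pi * (c * δ * (2 + δ) - 1 / (2 * Real.pi * c)) ^ 2 /
        (1 + 3 / 4 * (1 + δ) ^ 2 - 1 / (10 * Real.pi * c ^ 2))) /
        (2 * (1 + 3 / 4 * (1 + δ) ^ 2 - 1 / (10 * Real.pi * c ^ 2)))) ≤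
      if 0 ≤ δ then 1.85 else 1.9656 := by
  have hπ := Real.pi_pos
  have hπ1 := Real.pi_lt_d4
  have hπ2 := Real.pi_gt_d4
  have hc0 : 0 < c := by linarith
  obtain ⟨hd1, hd2⟩ := abs_le.1 h
  -- The worst case is c = 3/2; hence 1.7358 = 1.75 − 0.0142.
  have hε : 1 / (10 * Real.pi * c ^ 2) ≤ 0.0142 := by
    rw [div_le_iff₀ (by positivity)]
    have : (9 / 4 : ℝ) ≤ c ^ 2 := by nlinarith
    nlinarith
  have hB : 1.7358 + 1.5 * δ + 0.75 * δ ^ 2 ≤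
      1 + 3 / 4 * (1 + δ) ^ 2 - 1 / (10 * Real.pi * c ^ 2) := by linarith
  refine ⟨lt_of_lt_of_le (by nlinarith only [sq_nonneg δ, hδ]) hB, ?_⟩
  obtain ⟨η, hη⟩ : ∃ η, 1 / (2 * Real.pi * c) = η := ⟨_, rfl⟩
  rw [hη]
  have hη0 : 0 < η := by rw [← hη]; positivity
  have hηc : η * c = 1 / (2 * Real.pi) := by rw [← hη]; field_simp
  have hi1 : 0.159 ≤ 1 / (2 * Real.pi) := by rw [le_div_iff₀ (by positivity)]; linarith
  have hi2 : 1 / (2 * Real.pi) ≤ 0.16 := by rw [div_le_iff₀ (by positivity)]; linarith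
  have hη1 : η ≤ 0.107 := by nlinarith only [hηc, hi2, hc, hη0]
  split_ifs with h0
  · have hδ3 : δ ≤ 1 / 3 := by nlinarith only [hd2, hc, h0]
    refine sq_mul_gaussian_le_of_nonneg h0 hδ3 (sq_le_sq' ?_ ?_) hB
    · have : 0 ≤ c * δ * (2 + δ) := by positivity
      linarith
    -- From cδ ≤ 1/2 and cη = 1/(2π) ≥ 0.159. Since cδ(2+δ) ≤ 1 + δ/2, subtracting η leaves 1 +
    -- 0.182δ.
    · have h1 : 0.318 * δ ≤ η := by
        have : 0.318 * δ * c ≤ η * c := by rw [hηc]; linarith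
        exact le_of_mul_le_mul_right this hc0
      nlinarith only [h1, hd2, h0]
  · push Not at h0
    refine sq_mul_gaussian_le_of_nonpos h0.le hδ ?_ hB
    rw [sq_le_one_iff_abs_le_one, abs_le]
    constructor
    -- Expanded, this says cδ(2+δ) ≥ −1 + 1/(4c); the spare 1/(4c) absorbs η because 2π ≥ 4.
    · have h2 : 0 ≤ (1 + 2 * (c * δ)) * (1 - (1 / 2 - c * δ) / (2 * c)) := by
        refine mul_nonneg (by linarith) ?_
        rw [sub_nonneg, div_le_one (by positivity)]
        linarith
      have h3 : c * δ * (2 + δ) = 2 * (c * δ) + (c * δ) ^ 2 / c := by field_simp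
      have h4 : (1 + 2 * (c * δ)) * (1 - (1 / 2 - c * δ) / (2 * c)) =
          1 + 2 * (c * δ) + (c * δ) ^ 2 / c - 1 / (4 * c) := by
        field_simp
        ring
      have h5 : η ≤ 1 / (4 * c) := by
        rw [← hη]
        gcongr
        linarith
      rw [h3]
      linarith
    · have : c * δ * (2 + δ) ≤ 0 := by
        refine mul_nonpos_of_nonpos_of_nonneg ?_ (by linarith)
        exact (mul_neg_of_pos_of_neg hc0 h0).le
      linarith

/-- The contribution of the right tail. -/
theorem right_tail_le {c δ : ℝ} (hc : 3 / 2 ≤ c) (hδ : -0.2 ≤ δ) (hδ' : δ ≤ 1 / 3) :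
    0 < 1.75 - (1 + δ) ^ 2 / 2 ∧
    1 / 2 * Real.exp (-(2 * Real.pi * ((0.515625 - 0.2696 * (1 + δ) ^ 2) * c ^ 2))) *
      (1 / (2 * Real.pi * ((1.75 - (1 + δ) ^ 2 / 2) * c))) ≤ if 0 ≤ δ then 0.0375 else 0.002 := by
  have hπ2 := Real.pi_gt_d4
  have hc2 : 9 / 4 ≤ c ^ 2 := by nlinarith
  -- ρ bounds (1+δ)², and y is a rational lower bound for the exponential at c = 3/2. It is used
  -- with ρ = 16/9 for δ ≥ 0 and ρ = 1 for δ < 0.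
  have key : ∀ ρ μ y z : ℝ, (1 + δ) ^ 2 ≤ ρ → ρ < 3.5 → 0 ≤ 0.515625 - 0.2696 * ρ →
      z = 2 * 3.1415 * ((0.515625 - 0.2696 * ρ) * (9 / 4)) → 0 < y → y ≤ Real.exp z →
      1 ≤ y * (4 * 3.1415 * ((1.75 - ρ / 2) * (3 / 2))) * μ →
      1 / 2 * Real.exp (-(2 * Real.pi * ((0.515625 - 0.2696 * (1 + δ) ^ 2) * c ^ 2))) *
      (1 / (2 * Real.pi * ((1.75 - (1 + δ) ^ 2 / 2) * c))) ≤ μ := by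
    intro ρ μ y z h1 h2 h3 hz hy0 hy h4
    have e1 : z ≤ 2 * Real.pi * ((0.515625 - 0.2696 * (1 + δ) ^ 2) * c ^ 2) := by
      have : 0.515625 - 0.2696 * ρ ≤ 0.515625 - 0.2696 * (1 + δ) ^ 2 := by linarith
      have := h3.trans this
      rw [hz]
      gcongr
    have e2 : 2 * 3.1415 * ((1.75 - ρ / 2) * (3 / 2)) ≤
        2 * Real.pi * ((1.75 - (1 + δ) ^ 2 / 2) * c) := by
      have : 0 ≤ 1.75 - ρ / 2 := by linarith
      have : 0 ≤ 1.75 - (1 + δ) ^ 2 / 2 := by linarith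
      gcongr
    have e3 : 0 < 2 * 3.1415 * ((1.75 - ρ / 2) * (3 / 2)) := by nlinarith
    calc _ ≤ 1 / 2 * y⁻¹ * (1 / (2 * 3.1415 * ((1.75 - ρ / 2) * (3 / 2)))) := by
          rw [Real.exp_neg]
          have := hy.trans (Real.exp_le_exp.2 e1)
          have := e3.trans_le e2
          gcongr
      _ = 1 / (y * (4 * 3.1415 * ((1.75 - ρ / 2) * (3 / 2)))) := by
          field_simp
          norm_num
      _ ≤ μ := by
          rw [div_le_iff₀ (mul_pos hy0 (by linarith))]
          linarith
  have hr : (1 + δ) ^ 2 ≤ 16 / 9 := by nlinarith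
  refine ⟨by linarith, ?_⟩
  split_ifs with h0
  · refine key (16 / 9) _ 1.668 _ hr (by norm_num) (by norm_num) rfl (by norm_num) ?_ (by norm_num)
    refine le_trans ?_ (Real.sum_le_exp_of_nonneg (by norm_num) 4)
    norm_num [Finset.sum_range_succ, Nat.factorial]
  · push Not at h0
    refine key 1 _ 27 _ (by nlinarith) (by norm_num) (by norm_num) rfl (by norm_num) ?_
      (by norm_num)
    refine le_trans ?_ (Real.sum_le_exp_of_nonneg (by norm_num) 7)
    norm_num [Finset.sum_range_succ, Nat.factorial]

/-- The contribution of the left tail. -/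
theorem left_tail_le {c δ K : ℝ} (hc : 3 / 2 ≤ c) (hδ : -0.2 ≤ δ) (hδ' : δ ≤ 1 / 3)
    (hK : K ≤ √2 * max 1 (1 + δ)) :
    1 / 2 * K * Real.exp (-(2 * Real.pi * ((Real.pi / 4 * (1 + δ) ^ 2 - 1 / 4) * c ^ 2))) *
      (√(Real.pi / (2 * Real.pi)) / 2) ≤ if 0 ≤ δ then 0.01 else 0.0075 := by
  have hπ := Real.pi_pos
  have hπ2 := Real.pi_gt_d4
  have hc2 : 9 / 4 ≤ c ^ 2 := by nlinarith
  have hr : 0.64 ≤ (1 + δ) ^ 2 := by nlinarith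
  have hs : √(Real.pi / (2 * Real.pi)) = 1 / √2 := by
    rw [show Real.pi / (2 * Real.pi) = 1 / 2 by field_simp, Real.sqrt_div zero_le_one,
      Real.sqrt_one]
  have h2 : 0 < √2 := by positivity
  have hK' : K * (1 / √2) ≤ max 1 (1 + δ) := by
    rw [mul_one_div, div_le_iff₀ h2]; linarith
  have he : Real.exp (-(2 * Real.pi * ((Real.pi / 4 * (1 + δ) ^ 2 - 1 / 4) * c ^ 2))) ≤ 0.03 := by
    -- The worst case is δ = −0.2, c = 3/2.
    have e1 : 2 * 3.1415 * ((3.1415 / 4 * 0.64 - 1 / 4) * (9 / 4)) ≤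
        2 * Real.pi * ((Real.pi / 4 * (1 + δ) ^ 2 - 1 / 4) * c ^ 2) := by
      have e2 : (3.1415 / 4 * 0.64 - 1 / 4 : ℝ) ≤ Real.pi / 4 * (1 + δ) ^ 2 - 1 / 4 := by
        gcongr
      have e3 : (0 : ℝ) ≤ 3.1415 / 4 * 0.64 - 1 / 4 := by norm_num
      have e4 := e3.trans e2
      gcongr
    have e5 : (34 : ℝ) ≤ Real.exp (2 * 3.1415 * ((3.1415 / 4 * 0.64 - 1 / 4) * (9 / 4))) := by
      refine le_trans ?_ (Real.sum_le_exp_of_nonneg (by norm_num) 9)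
      norm_num [Finset.sum_range_succ, Nat.factorial]
    rw [Real.exp_neg]
    calc _ ≤ (34 : ℝ)⁻¹ := by
          have := e5.trans (Real.exp_le_exp.2 e1)
          gcongr
      _ ≤ 0.03 := by norm_num
  have hfin : 1 / 2 * K * Real.exp (-(2 * Real.pi * ((Real.pi / 4 * (1 + δ) ^ 2 - 1 / 4) * c ^ 2))) *
      (√(Real.pi / (2 * Real.pi)) / 2) ≤ 1 / 4 * max 1 (1 + δ) * 0.03 := by
    rw [hs]
    calc _ = 1 / 4 * (K * (1 / √2)) *
          Real.exp (-(2 * Real.pi * ((Real.pi / 4 * (1 + δ) ^ 2 - 1 / 4) * c ^ 2))) := by ring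
      _ ≤ _ := by gcongr
  refine hfin.trans ?_
  split_ifs with h0
  · rw [max_eq_right (by linarith)]; linarith
  · push Not at h0
    rw [max_eq_left (by linarith)]; norm_num

/-! ### Majorants for the weights 1 and a/‖x‖ -/

/-- Twice an upper bound for `1 / |e^{πix} - e^{-πix}|` on the lines `halfLine m`. -/
noncomputable def kernelBound (v : ℝ) : ℝ := if 1 / 2 ≤ |v| then 1 / 2 else 1

theorem kernelBound_nonneg (v : ℝ) : 0 ≤ kernelBound v := by
  unfold kernelBound; split_ifs <;> norm_num

theorem kernelBound_le_one (v : ℝ) : kernelBound v ≤ 1 := by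
  unfold kernelBound; split_ifs <;> norm_num

theorem inv_norm_exp_sub_exp_neg_le (m : ℕ) (v : ℝ) :
    1 / ‖Complex.exp (Real.pi * Complex.I * halfLine m v) -
      Complex.exp (-(Real.pi * Complex.I * halfLine m v))‖ ≤ kernelBound v / 2 := by
  have h2 := two_le_norm_exp_sub_exp_neg_halfLine m v
  rw [div_le_iff₀ (by linarith)]
  unfold kernelBound
  split_ifs with h
  · linarith [four_le_norm_exp_sub_exp_neg_halfLine m h]
  · linarith

section Majorant

variable {m : ℕ} {c δ : ℝ}

/-- The majorants of the integrand, for a weight function `w`. -/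
theorem exists_majorant_integral_le_sqrt_two (hc : c = m + 1 / 2) (hc' : 3 / 2 ≤ c)
    (hδ : -0.2 ≤ δ) (hd : |c * δ| ≤ 1 / 2) {w : ℝ → ℝ} {R A B K : ℝ} (hB : 0 < B) (hR : 0 ≤ R)
    (hK : 0 ≤ K) (hK' : K ≤ √2 * max 1 (1 + δ))
    (hmid : ∀ v, -(c / 2) ≤ v → v ≤ 3 / 8 * c →
      w v * Real.exp (2 * Real.pi * ((c * (1 + δ)) ^ 2 * (halfLine m v).arg - c * v - v ^ 2)) ≤
        R * Real.exp (A * v - B * v ^ 2))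
    (hw : ∀ v, 0 ≤ w v) (hright : ∀ v, 3 / 8 * c < v → w v ≤ 1)
    (hleft : ∀ v, v ≤ -(c / 2) → w v ≤ K)
    (hG : R ^ 2 * (Real.exp (A ^ 2 / (2 * B)) * (Real.pi / B)) ≤
      if 0 ≤ δ then 1.85 else 1.9656) :
    ∃ g : ℝ → ℝ, Integrable g ∧ (∀ v, w v * (kernelBound v *
      Real.exp (2 * Real.pi * ((c * (1 + δ)) ^ 2 * (halfLine m v).arg - c * v - v ^ 2))) ≤ g v) ∧
      ∫ v, g v ≤ √2 := by
  have hπ := Real.pi_pos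
  have hc0 : 0 < c := by linarith
  have hδ' : δ ≤ 1 / 3 := by nlinarith only [(abs_le.1 hd).2, hc']
  obtain ⟨hk, hRT⟩ := right_tail_le hc' hδ hδ'
  have hLT := left_tail_le hc' hδ hδ' hK'
  -- Both tails lie in |v| ≥ 1/2, since 3c/8 ≥ 9/16 and c/2 ≥ 3/4.
  have hhalf : ∀ v, 1 / 2 ≤ |v| → kernelBound v = 1 / 2 := fun v hv => if_pos hv
  have key := exists_integrable_majorant
    (F := fun v => w v * (kernelBound v *
      Real.exp (2 * Real.pi * ((c * (1 + δ)) ^ 2 * (halfLine m v).arg - c * v - v ^ 2))))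
    (b₁ := 3 / 8 * c) (b₂ := -(c / 2)) (R := R) (A := A) (B := B)
    (C₁ := 1 / 2 * Real.exp (-(2 * Real.pi * ((0.515625 - 0.2696 * (1 + δ) ^ 2) * c ^ 2))))
    (k₁ := 2 * Real.pi * ((1.75 - (1 + δ) ^ 2 / 2) * c))
    (C₂ := 1 / 2 * K * Real.exp (-(2 * Real.pi * ((Real.pi / 4 * (1 + δ) ^ 2 - 1 / 4) * c ^ 2))))
    (k₂ := 2 * Real.pi) hB hR (by positivity) (by positivity) (by positivity) (by positivity)
    (fun v h1 h2 => ?_) (fun v h1 => ?_) (fun v h1 => ?_)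
  · obtain ⟨g, hg, hle, hint⟩ := key
    refine ⟨g, hg, hle, ?_⟩
    rw [hint]
    -- The budgets 1.3602 + 0.0375 + 0.01 and 1.40201 + 0.002 + 0.0075 both stay below 1.414. The
    -- bound on the right tail is larger for δ ≥ 0 and the one on the Gaussian for δ < 0, hence the
    -- split.
    have hs : (1.414 : ℝ) ≤ √2 := Real.le_sqrt_of_sq_le (by norm_num)
    split_ifs at hG hRT hLT with h0
    · have := mul_exp_mul_sqrt_le (R := R) (A := A) (y := 1.3602) hB (by norm_num)
        (hG.trans (by norm_num))
      linarith
    · have := mul_exp_mul_sqrt_le (R := R) (A := A) (y := 1.40201) hB (by norm_num)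
        (hG.trans (by norm_num))
      linarith
  · refine le_trans ?_ (hmid v h1 h2)
    exact mul_le_mul_of_nonneg_left
      (mul_le_of_le_one_left (by positivity) (kernelBound_le_one v)) (hw v)
  · have hv : 1 / 2 ≤ |v| := by
      rw [abs_of_pos (by linarith)]; linarith
    simp only [hhalf v hv]
    refine (mul_le_of_le_one_left (by positivity) (hright v h1)).trans ?_
    rw [mul_assoc (1 / 2 : ℝ) (Real.exp _), ← Real.exp_add]
    refine mul_le_mul_of_nonneg_left (Real.exp_le_exp.2 ?_) (by norm_num)
    refine (mul_le_mul_of_nonneg_left (phase_le_linear (a := c * (1 + δ)) hc h1.le)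
      (by positivity : 0 ≤ 2 * Real.pi)).trans (le_of_eq ?_)
    field_simp
    ring
  · have hv : 1 / 2 ≤ |v| := by
      rw [abs_of_neg (by linarith)]; linarith
    simp only [hhalf v hv]
    refine (mul_le_mul_of_nonneg_right (hleft v h1) (by positivity)).trans ?_
    rw [← mul_assoc K, mul_comm K, mul_assoc (1 / 2 * K) (Real.exp _), ← Real.exp_add]
    refine mul_le_mul_of_nonneg_left (Real.exp_le_exp.2 ?_) (by positivity)
    refine (mul_le_mul_of_nonneg_left (phase_le_of_le_neg_half (a := c * (1 + δ)) hc h1)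
      (by positivity : 0 ≤ 2 * Real.pi)).trans (le_of_eq ?_)
    ring

theorem exists_majorant_zero (hc : c = m + 1 / 2) (hc' : 3 / 2 ≤ c)
    (hδ : -0.2 ≤ δ) (hd : |c * δ| ≤ 1 / 2) :
    ∃ g : ℝ → ℝ, Integrable g ∧ (∀ v, kernelBound v *
      Real.exp (2 * Real.pi * ((c * (1 + δ)) ^ 2 * (halfLine m v).arg - c * v - v ^ 2)) ≤ g v) ∧
      ∫ v, g v ≤ √2 := by
  have hπ := Real.pi_pos
  have hc0 : 0 < c := by linarith
  have hG := gaussian_term_zero_le hδ hd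
  have h2 : (1 : ℝ) ≤ √2 := Real.one_le_sqrt.2 (by norm_num)
  have h := exists_majorant_integral_le_sqrt_two (w := fun _ => 1) (R := 1)
    (A := 2 * Real.pi * (c * δ * (2 + δ))) (B := 2 * Real.pi * (1 + 3 / 4 * (1 + δ) ^ 2)) (K := 1)
    hc hc' hδ hd (by positivity) zero_le_one zero_le_one
    (by nlinarith [le_max_left 1 (1 + δ)]) (fun v h1 h2 => ?_) (fun _ => zero_le_one)
    (fun _ _ => le_rfl) (fun _ _ => le_rfl) ?_
  · simpa only [one_mul] using h
  · rw [one_mul, one_mul, Real.exp_le_exp]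
    refine (mul_le_mul_of_nonneg_left (phase_le_quadratic (a := c * (1 + δ)) hc h1 h2)
      (by positivity : 0 ≤ 2 * Real.pi)).trans (le_of_eq ?_)
    field_simp
    ring
  · refine le_trans (le_of_eq ?_) hG
    rw [one_pow, one_mul, div_eq_mul_inv (Real.exp _)]
    congr 1
    · congr 1
      field_simp
    · field_simp

theorem exists_majorant_one (hc : c = m + 1 / 2) (hc' : 3 / 2 ≤ c)
    (hδ : -0.2 ≤ δ) (hd : |c * δ| ≤ 1 / 2) :
    ∃ g : ℝ → ℝ, Integrable g ∧ (∀ v, c * (1 + δ) / ‖halfLine m v‖ * (kernelBound v *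
      Real.exp (2 * Real.pi * ((c * (1 + δ)) ^ 2 * (halfLine m v).arg - c * v - v ^ 2))) ≤ g v) ∧
      ∫ v, g v ≤ √2 := by
  have hπ := Real.pi_pos
  have hc0 : 0 < c := by linarith
  have hr : 0 < 1 + δ := by linarith
  have hδ' : δ ≤ 1 / 3 := by nlinarith only [(abs_le.1 hd).2, hc']
  obtain ⟨hB, hG⟩ := gaussian_term_one_le hc' hδ hd
  have h2 : 0 < √2 := by positivity
  refine exists_majorant_integral_le_sqrt_two (w := fun v => c * (1 + δ) / ‖halfLine m v‖)
    (R := 1 + δ) (A := 2 * Real.pi * (c * δ * (2 + δ) - 1 / (2 * Real.pi * c)))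
    (B := 2 * Real.pi * (1 + 3 / 4 * (1 + δ) ^ 2 - 1 / (10 * Real.pi * c ^ 2)))
    (K := √2 * (1 + δ)) hc hc' hδ hd (by positivity) hr.le (by positivity)
    (by gcongr; exact le_max_right _ _) (fun v h1 h2 => ?_) (fun v => by positivity)
    (fun v h1 => ?_) (fun v _ => ?_) ?_
  · have e1 := inv_norm_halfLine_le_exp hc h2
    have e2 : c * (1 + δ) / ‖halfLine m v‖ ≤
        (1 + δ) * Real.exp (-(v / c) + 1 / 5 * (v / c) ^ 2) := by
      calc _ = c * (1 + δ) * (1 / ‖halfLine m v‖) := by ring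
        _ ≤ c * (1 + δ) * (1 / c * Real.exp (-(v / c) + 1 / 5 * (v / c) ^ 2)) := by gcongr
        _ = _ := by field_simp
    refine (mul_le_mul_of_nonneg_right e2 (by positivity)).trans ?_
    rw [mul_assoc, ← Real.exp_add]
    gcongr
    have e3 := mul_le_mul_of_nonneg_left (phase_le_quadratic (a := c * (1 + δ)) hc h1 h2)
      (by positivity : 0 ≤ 2 * Real.pi)
    refine (add_le_add_right e3 _).trans (le_of_eq ?_)
    field_simp
    ring
  -- Here Re x ≥ 11c/8, while 1 + δ ≤ 4/3.
  · have hx : c * (1 + δ) ≤ ‖halfLine m v‖ := by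
      have e1 := (le_abs_self _).trans (Complex.abs_re_le_norm (halfLine m v))
      rw [halfLine_re, ← hc] at e1
      nlinarith
    exact div_le_one_of_le₀ hx (norm_nonneg _)
  · have e1 := half_le_norm_halfLine m v
    rw [← hc, div_le_iff₀ h2] at e1
    have hx : 0 < ‖halfLine m v‖ := by
      by_contra hx
      push Not at hx
      nlinarith
    rw [div_le_iff₀ hx]
    nlinarith
  · refine le_trans (le_of_eq ?_) hG
    rw [div_eq_mul_inv (Real.exp _)]
    have hB' := hB.ne'
    generalize 1 + 3 / 4 * (1 + δ) ^ 2 - 1 / (10 * Real.pi * c ^ 2) = B at *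
    congr 2
    · congr 1
      field_simp
    · field_simp

end Majorant

/-! ### Conclusion -/

/-- The bound for the shifted integral, from a bound for its weighted modulus. -/
theorem norm_integral_halfLine_le {m : ℕ} {s : ℂ} {a Y : ℝ} (hY : 0 ≤ Y)
    (ht : s.im = 2 * Real.pi * a ^ 2) {g : ℝ → ℝ} (hg : Integrable g) (hint : ∫ v, g v ≤ √2)
    (hle : ∀ v, ‖halfLine m v‖ ^ (-s.re) * (kernelBound v * Real.exp (2 * Real.pi *
      (a ^ 2 * (halfLine m v).arg - (m + 1 / 2) * v - v ^ 2))) ≤ Y * g v) :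
    ‖∫ v : ℝ, riemannAuxIntegrand s (halfLine m v) * (1 + Complex.I)‖ ≤ Y := by
  have hI : ‖1 + Complex.I‖ = √2 := by
    rw [Complex.norm_def]; congr 1; simp [Complex.normSq_apply]; norm_num
  have h2 : √2 * √2 = 2 := Real.mul_self_sqrt (by norm_num)
  -- √2 comes from |1+i| and 1/2 from the denominator, so a majorant of integral √2 gives exactly Y.
  refine (norm_integral_le_of_norm_le (hg.const_mul (√2 / 2 * Y))
    (Eventually.of_forall fun v => ?_)).trans ?_
  · have hx : halfLine m v ≠ 0 := Complex.slitPlane_ne_zero (halfLine_mem_slitPlane m v)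
    rw [norm_mul, hI, norm_riemannAuxIntegrand s hx, halfLine_re, halfLine_im, ht, ← mul_one_div]
    have hk := inv_norm_exp_sub_exp_neg_le m v
    have hφ : 2 * Real.pi * a ^ 2 * (halfLine m v).arg - 2 * Real.pi * ((m + 1 / 2 + v) * v) =
        2 * Real.pi * (a ^ 2 * (halfLine m v).arg - (m + 1 / 2) * v - v ^ 2) := by ring
    rw [hφ]
    calc _ ≤ ‖halfLine m v‖ ^ (-s.re) * Real.exp (2 * Real.pi *
          (a ^ 2 * (halfLine m v).arg - (m + 1 / 2) * v - v ^ 2)) * (kernelBound v / 2) * √2 := by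
          gcongr
      _ = √2 / 2 * (‖halfLine m v‖ ^ (-s.re) * (kernelBound v * Real.exp (2 * Real.pi *
          (a ^ 2 * (halfLine m v).arg - (m + 1 / 2) * v - v ^ 2)))) := by ring
      _ ≤ √2 / 2 * (Y * g v) := mul_le_mul_of_nonneg_left (hle v) (by positivity)
      _ = _ := by ring
  · rw [integral_const_mul]
    calc √2 / 2 * Y * ∫ v, g v ≤ √2 / 2 * Y * √2 := by gcongr
      _ = Y := by linear_combination Y / 2 * h2

theorem mainTheorem1 :
    (∀ σ t : ℝ, 0 ≤ σ → σ ≤ 1 → 3 * Real.pi ≤ t →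
      ‖riemannAux (σ + t * Complex.I) -
          ∑ n ∈ Finset.Icc 1 ⌊Real.sqrt (t / (2 * Real.pi))⌋₊,
            1 / (n : ℂ) ^ ((σ : ℂ) + t * Complex.I)‖
        ≤ (t / (2 * Real.pi)) ^ (-σ / 2)) ∧
    (∀ σ t : ℝ, 1 ≤ σ → 16 * Real.pi ≤ t →
      ‖riemannAux (σ + t * Complex.I) -
          ∑ n ∈ Finset.Icc 1 ⌊Real.sqrt (t / (2 * Real.pi))⌋₊,
            1 / (n : ℂ) ^ ((σ : ℂ) + t * Complex.I)‖
        ≤ (t / (2 * Real.pi)) ^ (-1 / 2 : ℝ)) := by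
  have hπ := Real.pi_pos
  have setup : ∀ t : ℝ, 3 * Real.pi ≤ t → ∀ N : ℕ, N = ⌊√(t / (2 * Real.pi))⌋₊ →
      ∃ c δ : ℝ, c = N + 1 / 2 ∧ 3 / 2 ≤ c ∧ -0.2 ≤ δ ∧ |c * δ| ≤ 1 / 2 ∧
        √(t / (2 * Real.pi)) = c * (1 + δ) := by
    intro t ht N hN
    have hq : 3 / 2 ≤ t / (2 * Real.pi) := by rw [le_div_iff₀ (by positivity)]; linarith
    have hsq := Real.sq_sqrt (show 0 ≤ t / (2 * Real.pi) by linarith)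
    set a := √(t / (2 * Real.pi)) with ha
    have ha0 : 0 ≤ a := Real.sqrt_nonneg _
    have ha1 : 1.2 ≤ a := by nlinarith
    have hN1 : 1 ≤ N := by rw [hN]; exact Nat.le_floor (by norm_num; linarith)
    have hNa : (N : ℝ) ≤ a := by rw [hN]; exact Nat.floor_le ha0
    have haN : a < N + 1 := by rw [hN]; exact Nat.lt_floor_add_one a
    have hN1' : (1 : ℝ) ≤ N := by exact_mod_cast hN1
    have hc0 : (0 : ℝ) < N + 1 / 2 := by positivity
    refine ⟨N + 1 / 2, a / (N + 1 / 2) - 1, rfl, by linarith, ?_, ?_, ?_⟩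
    -- For N = 1 this needs a ≥ 1.2, supplied by t ≥ 3π; for N ≥ 2 already N/(N + 1/2) ≥ 4/5.
    · have : 0.8 ≤ a / (N + 1 / 2) := by
        rw [le_div_iff₀ hc0]
        rcases hN1.eq_or_lt with h | h
        · rw [← h]; norm_num; linarith
        · have : (2 : ℝ) ≤ N := by exact_mod_cast h
          linarith
      linarith
    · have : (N + 1 / 2 : ℝ) * (a / (N + 1 / 2) - 1) = a - (N + 1 / 2) := by field_simp
      rw [this, abs_le]
      constructor <;> linarith
    · field_simp
      ring
  have him : ∀ t : ℝ, 3 * Real.pi ≤ t → t = 2 * Real.pi * √(t / (2 * Real.pi)) ^ 2 := by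
    intro t ht
    rw [Real.sq_sqrt (div_nonneg (by linarith) (by positivity))]
    field_simp
  constructor
  · intro σ t hσ0 hσ1 ht
    obtain ⟨N, hN⟩ : ∃ N, N = ⌊√(t / (2 * Real.pi))⌋₊ := ⟨_, rfl⟩
    have hs : ((σ : ℂ) + t * Complex.I).re = σ := by simp
    have hs' : ((σ : ℂ) + t * Complex.I).im = t := by simp
    rw [← hN, riemannAux_sub_sum (by rw [hs]; exact hσ0), norm_neg]
    obtain ⟨c, δ, hc, hc', hδ, hd, ha⟩ := setup t ht N hN
    obtain ⟨g₀, hg₀, hle₀, hint₀⟩ := exists_majorant_zero hc hc' hδ hd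
    obtain ⟨g₁, hg₁, hle₁, hint₁⟩ := exists_majorant_one hc hc' hδ hd
    have hpos : 0 < c * (1 + δ) := mul_pos (by linarith) (by linarith)
    have hY : (t / (2 * Real.pi)) ^ (-σ / 2) = (c * (1 + δ)) ^ (-σ) := by
      rw [← ha, Real.sqrt_eq_rpow, ← Real.rpow_mul (div_nonneg (by linarith) (by positivity))]
      ring_nf
    rw [hY]
    refine norm_integral_halfLine_le (a := c * (1 + δ)) (g := fun v => (1 - σ) * g₀ v + σ * g₁ v)
      (by positivity) (by rw [hs', ← ha]; exact him t ht)
      ((hg₀.const_mul _).add (hg₁.const_mul _)) ?_ fun v => ?_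
    · rw [integral_add (hg₀.const_mul _) (hg₁.const_mul _), integral_const_mul,
        integral_const_mul]
      nlinarith [mul_le_mul_of_nonneg_left hint₀ (sub_nonneg.2 hσ1),
        mul_le_mul_of_nonneg_left hint₁ hσ0]
    · have hx : 0 < ‖halfLine N v‖ :=
        norm_pos_iff.2 (Complex.slitPlane_ne_zero (halfLine_mem_slitPlane N v))
      rw [hs, ← hc]
      -- Weighted AM–GM makes the same convex combination of the two majorants work for σ.
      have hamgm : (c * (1 + δ) / ‖halfLine N v‖) ^ σ ≤
          (1 - σ) + σ * (c * (1 + δ) / ‖halfLine N v‖) := by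
        have := Real.geom_mean_le_arith_mean2_weighted (sub_nonneg.2 hσ1) hσ0 zero_le_one
          (by positivity : 0 ≤ c * (1 + δ) / ‖halfLine N v‖) (by ring)
        simpa using this
      have hfac : ‖halfLine N v‖ ^ (-σ) =
          (c * (1 + δ)) ^ (-σ) * (c * (1 + δ) / ‖halfLine N v‖) ^ σ := by
        rw [Real.div_rpow hpos.le hx.le, Real.rpow_neg hpos.le, Real.rpow_neg hx.le]
        have := (Real.rpow_pos_of_pos hpos σ).ne'
        field_simp
      rw [hfac, mul_assoc]
      refine mul_le_mul_of_nonneg_left ?_ (by positivity)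
      have hE : 0 ≤ kernelBound v * Real.exp (2 * Real.pi *
          ((c * (1 + δ)) ^ 2 * (halfLine N v).arg - c * v - v ^ 2)) :=
        mul_nonneg (kernelBound_nonneg v) (by positivity)
      refine (mul_le_mul_of_nonneg_right hamgm hE).trans ?_
      have e0 := mul_le_mul_of_nonneg_left (hle₀ v) (sub_nonneg.2 hσ1)
      have e1 := mul_le_mul_of_nonneg_left (hle₁ v) hσ0
      rw [add_mul, mul_assoc σ]
      exact add_le_add e0 e1
  · intro σ t hσ ht
    have ht3 : 3 * Real.pi ≤ t := by linarith
    obtain ⟨N, hN⟩ : ∃ N, N = ⌊√(t / (2 * Real.pi))⌋₊ := ⟨_, rfl⟩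
    have hs : ((σ : ℂ) + t * Complex.I).re = σ := by simp
    have hs' : ((σ : ℂ) + t * Complex.I).im = t := by simp
    rw [← hN, riemannAux_sub_sum (by rw [hs]; linarith), norm_neg]
    obtain ⟨c, δ, hc, hc', hδ, hd, ha⟩ := setup t ht3 N hN
    obtain ⟨g, hg, hle, hint⟩ := exists_majorant_one hc hc' hδ hd
    have hpos : 0 < c * (1 + δ) := mul_pos (by linarith) (by linarith)
    have hY : (t / (2 * Real.pi)) ^ (-1 / 2 : ℝ) = (c * (1 + δ))⁻¹ := by
      rw [← ha, Real.sqrt_eq_rpow, ← Real.rpow_neg (div_nonneg (by linarith) (by positivity))]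
      ring_nf
    rw [hY]
    have hN2 : (2 : ℝ) ≤ N := by
      have : 2 ≤ N := by
        rw [hN]
        refine Nat.le_floor (Real.le_sqrt_of_sq_le ?_)
        rw [le_div_iff₀ (by positivity)]
        norm_num
        linarith
      exact_mod_cast this
    refine norm_integral_halfLine_le (a := c * (1 + δ)) (g := g) (by positivity)
      (by rw [hs', ← ha]; exact him t ht3) hg hint fun v => ?_
    -- The distance from 0 to the line is c/√2, which exceeds 1; this makes ‖x‖^{-σ} decrease in σ.
    have hx : 1 ≤ ‖halfLine N v‖ := by
      refine le_trans ?_ (half_le_norm_halfLine N v)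
      rw [le_div_iff₀ (by positivity), one_mul, Real.sqrt_le_left (by positivity)]
      nlinarith
    rw [hs, ← hc]
    have hfac : ‖halfLine N v‖ ^ (-σ) ≤ (c * (1 + δ))⁻¹ * (c * (1 + δ) / ‖halfLine N v‖) := by
      calc ‖halfLine N v‖ ^ (-σ) ≤ ‖halfLine N v‖ ^ (-1 : ℝ) :=
            Real.rpow_le_rpow_of_exponent_le hx (by linarith)
        _ = ‖halfLine N v‖⁻¹ := Real.rpow_neg_one _
        _ = _ := by rw [← mul_div_assoc, inv_mul_cancel₀ hpos.ne', one_div]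
    have hE : 0 ≤ kernelBound v * Real.exp (2 * Real.pi *
        ((c * (1 + δ)) ^ 2 * (halfLine N v).arg - c * v - v ^ 2)) :=
      mul_nonneg (kernelBound_nonneg v) (by positivity)
    refine (mul_le_mul_of_nonneg_right hfac hE).trans ?_
    rw [mul_assoc]
    exact mul_le_mul_of_nonneg_left (hle v) (by positivity)
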